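/- All rings are associative and unitary, and $C$, $A$, $B$ denote rings. A class $\mathcal C$ of right $C$-modules is *exact* if it is stable under filtered colimits and if, for every short exact sequence $0\to M\to N\to P\to 0$ of right $C$-modules two of whose terms lie in $\mathcal C$, the third lies in $\mathcal C$ as well. The ring $C$ is *right regular* (in the sense of Vogel) if every right $C$-module lies in the smallest exact class containing the right module $C$, i.e. if the class of all right $C$-modules is the only exact class containing $C$. A ring homomorphism $\alpha:C\to A$ is a *pure embedding with complement free from the left* if $\alpha$ is injective and there is a splitting of $C$-bimodules $A=\alpha(C)\oplus A'$ in which $A'$ is free as a left $C$-module. Let the ring $R$ be one of the following. 1. The (generalized) free product in the situation $\alpha:C\to A$, $\beta:C\to B$, that is, the pushout $A*_C B$ in the category of rings, where $\alpha$ and $\beta$ are pure embeddings with complements free from the left. Suppose that $C$, $A$ and $B$ are right regular. 2. The (generalized) Laurent extension with respect to $\alpha,\beta:C\to A$, that is, the universal ring $R$ equipped with a ring homomorphism $A\to R$ and an invertible element $t\in R$ such that $\alpha(c)\,t=t\,\beta(c)$ in $R$ for all $c\in C$, where $\alpha$ and $\beta$ are pure embeddings with complements free from the left. Suppose that $C$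 and $A$ are right regular. 3. The tensor algebra $C\oplus S\oplus (S\otimes_C S)\oplus\cdots$ of a $C$-bimodule $S$ that is free as a left $C$-module, that is, the universal ring $R$ equipped with a ring homomorphism $C\to R$ and a homomorphism of $C$-bimodules $S\to R$. Suppose that $C$ is right regular. Then, in each of the three cases, the ring $R$ is right regular. -/

import Mathlib

open CategoryTheory CategoryTheory.Limits MulOpposite

universe u

namespace VogelRegular

/-- The category of right modules over a (unitary, associative) ring `C`, i.e. of left modules over
the opposite ring. -/
abbrev RightMod (C : Type u) [Ring C] := ModuleCat.{u} Cᵐᵒᵖ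

/-- A class of right `C`-modules is exact if it is stable under filtered colimits and satisfies the
2/3 axiom: if two of the modules in a short exact sequence are in the class, so is the third.
(A colimit being any colimit cocone, such a class is closed under isomorphism.) -/
structure IsExactClass {C : Type u} [Ring C] (P : ObjectProperty (RightMod C)) : Prop where
  filtered_colimit : ∀ (J : Type u) [SmallCategory J] [IsFiltered J] (F : J ⥤ RightMod C)
    (c : Cocone F), IsColimit c → (∀ j, P (F.obj j)) → P c.pt
  left : ∀ E : ShortComplex (RightMod C), E.ShortExact → P E.X₂ → P E.X₃ → P E.X₁
  middle : ∀ E : ShortComplex (RightMod C), E.ShortExact → P E.X₁ → P E.X₃ → P E.X₂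
  right : ∀ E : ShortComplex (RightMod C), E.ShortExact → P E.X₁ → P E.X₂ → P E.X₃

/-- The class of regular right `C`-modules: the smallest exact class containing `C`. -/
def regularModules (C : Type u) [Ring C] : ObjectProperty (RightMod C) := fun M =>
  ∀ P : ObjectProperty (RightMod C), IsExactClass P → P (ModuleCat.of Cᵐᵒᵖ C) → P M

/-- The ring `C` is right regular in the sense of Vogel: every right `C`-module is regular. -/
def IsRightRegular (C : Type u) [Ring C] : Prop :=
  ∀ M : RightMod C, regularModules C M

/-- `α : C → A` is a pure embedding with complement free from the left: `α` is injective, and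
`A = α(C) ⊕ A'` for some sub-`C`-bimodule `A'` of `A` that is free as a left `C`-module. Here
`C` acts on `A` by multiplication through `α` on either side. -/
def IsPureEmbeddingLeftFree {C A : Type u} [Ring C] [Ring A] (α : C →+* A) : Prop :=
  letI : Module C A := Module.compHom A α
  Function.Injective α ∧
    ∃ A' : Submodule C A, (∀ c : C, ∀ a ∈ A', a * α c ∈ A') ∧
      IsCompl α.toAddMonoidHom.range A'.toAddSubgroup ∧ Module.Free C A'

/-- `R`, with the maps `i : A → R` and `j : B → R`, is the (generalized) free product of `A` and `B`
amalgamated over `C` along `α` and `β`: the pushout in the category of rings. -/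
def IsFreeProduct {C A B R : Type u} [Ring C] [Ring A] [Ring B] [Ring R]
    (α : C →+* A) (β : C →+* B) (i : A →+* R) (j : B →+* R) : Prop :=
  IsPushout (RingCat.ofHom α) (RingCat.ofHom β) (RingCat.ofHom i) (RingCat.ofHom j)

/-- `R`, with the map `i : A → R` and the invertible element `t`, is the (generalized) Laurent
extension of `A` with respect to `α, β : C → A`: the universal ring under `A` with an invertible
element `t` such that `α(c) t = t β(c)` for all `c`. -/
structure IsLaurentExtension {C A R : Type u} [Ring C] [Ring A] [Ring R]
    (α β : C →+* A) (i : A →+* R) (t : Rˣ) : Prop where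
  comm : ∀ c : C, i (α c) * (t : R) = (t : R) * i (β c)
  existsUnique_lift : ∀ (T : Type u) [Ring T] (f : A →+* T) (s : Tˣ),
    (∀ c : C, f (α c) * (s : T) = (s : T) * f (β c)) →
      ∃! h : R →+* T, h.comp i = f ∧ h (t : R) = (s : T)

/-- `R`, with the maps `i : C → R` and `j : S → R`, is the tensor algebra of the `C`-bimodule `S`:
the universal ring under `C` with a map of `C`-bimodules from `S`. -/
structure IsTensorAlgebra {C S R : Type u} [Ring C] [AddCommGroup S] [Module C S]
    [Module Cᵐᵒᵖ S] [Ring R] (i : C →+* R) (j : S →+ R) : Prop where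
  map_left : ∀ (c : C) (x : S), j (c • x) = i c * j x
  map_right : ∀ (c : C) (x : S), j (op c • x) = j x * i c
  existsUnique_lift : ∀ (T : Type u) [Ring T] (f : C →+* T) (g : S →+ T),
    (∀ (c : C) (x : S), g (c • x) = f c * g x) →
    (∀ (c : C) (x : S), g (op c • x) = g x * f c) →
      ∃! h : R →+* T, h.comp i = f ∧ ∀ x : S, h (j x) = g x

end VogelRegular

namespace VogelRegular

/-! Fix an exact class containing `R` and a right `R`-module `M`; the goal is a short exact sequence
ending in `M` whose other terms are visibly in the class. Visible members come from extension of
scalars: if `R` is free as a left `A`-module, then `N ↦ N ⊗_A R` is exact, preserves colimits and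
sends `A` to `R`. The modules `N` with `N ⊗_A R` in the class therefore form an exact class
containing `A`, and this is everything when `A` is right regular (`IsRightRegular.extension_mem`).

The sequences are, with `M` restricted to the smaller rings, `0 → M ⊗_C R → M ⊗_A R ⊕ M ⊗_B R → M →
0` for free products, `0 → M ⊗_C R → M ⊗_A R → M → 0` with first map `m ⊗ r ↦ m ⊗ r - mt ⊗ t⁻¹r` for
Laurent extensions, and `0 → (M ⊗_C S) ⊗_C R → M ⊗_C R → M → 0` with first map `m ⊗ s ⊗ r ↦ m ⊗ sr -
ms ⊗ r` for tensor algebras.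

Both freeness and exactness come from normal forms. Following van der Waerden, the universal
property makes `R` act on the free module on reduced words, and `exists_basis_of_action` turns this
action into a left basis of `R` by words. On that basis an additive contraction of each sequence is
defined by recursion on the word: letters are carried across the tensor sign one at a time and the
differences telescope (the lemmas `mem_of_tens_mem`, through `IsExactClass.mem_of_contraction`). -/

theorem mapRange_exact {ι N N' N'' : Type*} [AddCommGroup N] [AddCommGroup N'] [AddCommGroup N'']
    (f : N →+ N') (g : N' →+ N'') (h : Function.Exact f g) :
    Function.Exact (Finsupp.mapRange.addMonoidHom (ι := ι) f)
      (Finsupp.mapRange.addMonoidHom g) := by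
  classical
  intro x
  constructor
  · intro hx
    have hx' : ∀ k, g (x k) = 0 := fun k => DFunLike.congr_fun hx k
    choose y hy using fun k => (h _).1 (hx' k)
    -- The preimage chosen for `0` need not be `0`, so it is overwritten off the support of `x` to
    -- keep the support finite.
    refine ⟨Finsupp.onFinset x.support (fun k => if x k = 0 then 0 else y k) fun k hk => ?_, ?_⟩
    · rw [Finsupp.mem_support_iff]
      intro h0
      simp [h0] at hk
    · refine Finsupp.ext fun k => ?_
      change f (if x k = 0 then 0 else y k) = _
      split_ifs with h0
      · rw [map_zero, h0]
      · exact hy k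
  · rintro ⟨y, rfl⟩
    exact Finsupp.ext fun k => h.apply_apply_eq_zero (y k)

/-! ### Tensor products with a bimodule that has a left basis, in coordinates -/

section Tens

/-- The tensor product over `C` of a right `C`-module `N` with a bimodule `S` that has a left
`C`-basis indexed by `ι`, realized on the finitely supported functions from `ι` to `N`. -/
def Tens {ι C S : Type*} [Ring C] [AddCommGroup S] [Module C S] (_ : Module.Basis ι C S)
    (N : Type*) [AddCommGroup N] : Type _ := ι →₀ N

namespace Tens

variable {ι C D S : Type*} [Ring C] [Ring D] [AddCommGroup S] [Module C S] [Module Dᵐᵒᵖ S]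
variable (b : Module.Basis ι C S) {N N' X : Type*} [AddCommGroup N] [AddCommGroup N']
  [AddCommGroup X]

noncomputable instance : AddCommGroup (Tens b N) := inferInstanceAs (AddCommGroup (ι →₀ N))

/-- The element `n ⊗ b k`. -/
noncomputable def single (k : ι) : N →+ Tens b N := Finsupp.singleAddHom k

/-- The additive map determined by the images of the elements `n ⊗ b k`. -/
noncomputable def extend (g : ι → N →+ X) : Tens b N →+ X := Finsupp.liftAddHom g

@[simp] theorem extend_single (g : ι → N →+ X) (k : ι) (n : N) :
    extend b g (single b k n) = g k n :=
  Finsupp.liftAddHom_apply_single g k n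

variable {b} in
theorem addHom_ext {f g : Tens b N →+ X} (h : ∀ k n, f (single b k n) = g (single b k n)) :
    f = g :=
  Finsupp.addHom_ext h

variable [Module Cᵐᵒᵖ N] [Module Cᵐᵒᵖ N']

/-- The element `n ⊗ s`. -/
noncomputable def tmul : N →+ S →+ Tens b N :=
  AddMonoidHom.mk' (fun n => (Finsupp.liftAddHom fun k =>
      (single b k).comp (AddMonoidHom.mk' (fun c : C => op c • n)
        fun x y => by rw [MulOpposite.op_add, add_smul])).comp b.repr.toAddEquiv.toAddMonoidHom) fun x y => by
    rw [← AddMonoidHom.add_comp, ← map_add]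
    congr 2
    ext k c : 2
    simp

theorem tmul_smul_basis (n : N) (c : C) (k : ι) : tmul b n (c • b k) = single b k (op c • n) := by
  simp only [tmul, AddMonoidHom.mk'_apply, AddMonoidHom.comp_apply]
  have : b.repr.toAddEquiv.toAddMonoidHom (c • b k) = Finsupp.single k c := by
    simp [Module.Basis.repr_self]
  rw [this, Finsupp.liftAddHom_apply_single]
  rfl

theorem tmul_basis (n : N) (k : ι) : tmul b n (b k) = single b k n := by
  simpa using tmul_smul_basis b n 1 k

include b in
theorem addHom_ext_basis {f g : S →+ X} (h : ∀ (c : C) k, f (c • b k) = g (c • b k)) : f = g := by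
  have : f.comp b.repr.symm.toLinearMap.toAddMonoidHom =
      g.comp b.repr.symm.toLinearMap.toAddMonoidHom := by
    ext k c
    simpa using h c k
  ext s
  simpa using DFunLike.congr_fun this (b.repr s)

theorem smul_tmul_left (n : N) (c : C) (s : S) : tmul b (op c • n) s = tmul b n (c • s) := by
  suffices tmul b (op c • n) = (tmul b n).comp (DistribSMul.toAddMonoidHom S c) from
    DFunLike.congr_fun this s
  refine addHom_ext_basis b fun c' k => ?_
  simp only [AddMonoidHom.comp_apply, DistribSMul.toAddMonoidHom_apply, smul_smul,
    tmul_smul_basis, op_mul]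

/-- The additive map out of the tensor product induced by a balanced biadditive map. -/
noncomputable def lift (g : N →+ S →+ X) : Tens b N →+ X := extend b fun k => g.flip (b k)

/-- `lift` reads `g` only on basis elements, so it makes sense for any biadditive map; balancing is
what extends the formula from basis elements to all of `S`. -/
theorem lift_tmul (g : N →+ S →+ X) (hg : ∀ (n : N) (c : C) (s : S), g (op c • n) s = g n (c • s))
    (n : N) (s : S) :
    lift b g (tmul b n s) = g n s := by
  suffices (lift b g).comp (tmul b n) = g n from DFunLike.congr_fun this s
  refine addHom_ext_basis b fun c k => ?_
  simp [tmul_smul_basis, lift, hg]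

variable {b} in
theorem addHom_ext_tmul {f g : Tens b N →+ X} (h : ∀ n k, f (tmul b n (b k)) = g (tmul b n (b k))) :
    f = g :=
  addHom_ext fun k n => by simpa only [tmul_basis] using h n k

section Module

variable [SMulCommClass C Dᵐᵒᵖ S]

variable (N) in
/-- The right action of `D` on the tensor product, through the bimodule. -/
noncomputable def action (d : Dᵐᵒᵖ) : Tens b N →+ Tens b N :=
  lift b ((AddMonoidHom.compHom.flip (DistribSMul.toAddMonoidHom S d)).comp (tmul b))

theorem action_tmul (d : Dᵐᵒᵖ) (n : N) (s : S) : action b N d (tmul b n s) = tmul b n (d • s) := by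
  rw [action, lift_tmul]
  · rfl
  · intro n c s
    simp [smul_tmul_left, smul_comm c d s]

noncomputable instance : Module Dᵐᵒᵖ (Tens b N) where
  smul d x := action b N d x
  one_smul x := by
    change action b N 1 x = AddMonoidHom.id _ x
    refine DFunLike.congr_fun (addHom_ext_tmul fun n k => ?_) x
    simp [action_tmul]
  mul_smul d e x := by
    change action b N (d * e) x = ((action b N d).comp (action b N e)) x
    refine DFunLike.congr_fun (addHom_ext_tmul fun n k => ?_) x
    simp [action_tmul, mul_smul]
  smul_zero d := map_zero _
  smul_add d := map_add _
  add_smul d e x := by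
    change action b N (d + e) x = (action b N d + action b N e) x
    refine DFunLike.congr_fun (addHom_ext_tmul fun n k => ?_) x
    simp [action_tmul, add_smul]
  zero_smul x := by
    change action b N 0 x = (0 : Tens b N →+ Tens b N) x
    refine DFunLike.congr_fun (addHom_ext_tmul fun n k => ?_) x
    simp [action_tmul]

theorem smul_tmul (d : Dᵐᵒᵖ) (n : N) (s : S) : d • tmul b n s = tmul b n (d • s) :=
  action_tmul b d n s

variable (D) in
variable {b} in
/-- An additive map out of the tensor product is linear as soon as it is so on pure tensors. -/
noncomputable def toLinear [Module Dᵐᵒᵖ X] (f : Tens b N →+ X)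
    (hf : ∀ (d : Dᵐᵒᵖ) n s, f (tmul b n (d • s)) = d • f (tmul b n s)) : Tens b N →ₗ[Dᵐᵒᵖ] X where
  toFun := f
  map_add' := map_add f
  map_smul' d x := by
    change (f.comp (DistribSMul.toAddMonoidHom _ d)) x =
      ((DistribSMul.toAddMonoidHom _ d).comp f) x
    refine DFunLike.congr_fun (addHom_ext_tmul fun n k => ?_) x
    simp [smul_tmul, hf]

@[simp] theorem toLinear_apply [Module Dᵐᵒᵖ X] (f : Tens b N →+ X)
    (hf : ∀ (d : Dᵐᵒᵖ) n s, f (tmul b n (d • s)) = d • f (tmul b n s)) (x : Tens b N) :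
    toLinear D f hf x = f x := rfl

/-- The map of tensor products induced by a linear map. -/
noncomputable def mapHom (f : N →ₗ[Cᵐᵒᵖ] N') : Tens b N →+ Tens b N' :=
  Finsupp.mapRange.addMonoidHom f.toAddMonoidHom

theorem mapHom_single (f : N →ₗ[Cᵐᵒᵖ] N') (k : ι) (n : N) :
    mapHom b f (single b k n) = single b k (f n) :=
  Finsupp.mapRange_single (hf := map_zero f)

theorem mapHom_tmul (f : N →ₗ[Cᵐᵒᵖ] N') (n : N) (s : S) :
    mapHom b f (tmul b n s) = tmul b (f n) s := by
  suffices (mapHom b f).comp (tmul b n) = tmul b (f n) from DFunLike.congr_fun this s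
  refine addHom_ext_basis b fun c k => ?_
  simp [tmul_smul_basis, mapHom_single]

variable (D) in
/-- `mapHom` as a linear map. -/
noncomputable def map (f : N →ₗ[Cᵐᵒᵖ] N') : Tens b N →ₗ[Dᵐᵒᵖ] Tens b N' :=
  toLinear D (mapHom b f) fun d n s => by simp only [mapHom_tmul, smul_tmul]

theorem map_exact {N'' : Type*} [AddCommGroup N''] [Module Cᵐᵒᵖ N''] (f : N →ₗ[Cᵐᵒᵖ] N')
    (g : N' →ₗ[Cᵐᵒᵖ] N'') (h : Function.Exact f g) :
    Function.Exact (map D b f) (map D b g) :=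
  mapRange_exact f.toAddMonoidHom g.toAddMonoidHom h

end Module

end Tens

end Tens

/-! ### The overring as a bimodule -/

section Via

/-- The ring `R` regarded as a bimodule, on the left over `A` through a ring homomorphism and on
the right over itself. -/
def Via {A R : Type*} [Ring A] [Ring R] (_ : A →+* R) : Type _ := R

namespace Via

variable {A R : Type*} [Ring A] [Ring R] (i : A →+* R)

instance : AddCommGroup (Via i) := inferInstanceAs (AddCommGroup R)
instance : Module A (Via i) := Module.compHom R i
instance : Module Rᵐᵒᵖ (Via i) := inferInstanceAs (Module Rᵐᵒᵖ R)
instance : SMulCommClass A Rᵐᵒᵖ (Via i) where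
  smul_comm a r x := by
    exact (mul_assoc (i a) (show R from x) r.unop).symm

/-- The identity of `R` as a map to `Via i`. -/
def of : R ≃+ Via i := AddEquiv.refl R

theorem smul_of (a : A) (r : R) : a • of i r = of i (i a * r) := rfl

theorem op_smul_of (s : Rᵐᵒᵖ) (r : R) : s • of i r = of i (r * s.unop) := rfl

end Via

end Via

/-! ### Extension of scalars and its adjunction with restriction -/

section Functor

variable {A R : Type u} [Ring A] [Ring R] {i : A →+* R} {ι : Type u}
  (b : Module.Basis ι A (Via i))

/-- Extension of scalars along a ring homomorphism with a given left basis. -/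
noncomputable def extension : RightMod A ⥤ RightMod R where
  obj N := ModuleCat.of Rᵐᵒᵖ (Tens b N)
  map f := ModuleCat.ofHom (Tens.map R b f.hom)
  map_id N := by
    refine ModuleCat.hom_ext (LinearMap.toAddMonoidHom_injective
      (Tens.addHom_ext_tmul fun n k => ?_))
    simp [Tens.map, Tens.mapHom_tmul]
  map_comp f g := by
    refine ModuleCat.hom_ext (LinearMap.toAddMonoidHom_injective
      (Tens.addHom_ext_tmul fun n k => ?_))
    simp [Tens.map, Tens.mapHom_tmul]

/-- The right action on a module as a biadditive map. -/
def rsmul (i : A →+* R) (M : Type*) [AddCommGroup M] [Module Rᵐᵒᵖ M] : M →+ Via i →+ M :=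
  AddMonoidHom.mk' (fun m => AddMonoidHom.mk' (fun r => op ((Via.of i).symm r) • m)
    fun x y => by rw [map_add, MulOpposite.op_add, add_smul]) fun x y => by
      ext r
      exact smul_add _ _ _

theorem rsmul_apply {M : Type*} [AddCommGroup M] [Module Rᵐᵒᵖ M] (m : M) (r : R) :
    rsmul i M m (Via.of i r) = op r • m := rfl

section

variable {N M : Type*} [AddCommGroup N] [Module Aᵐᵒᵖ N] [AddCommGroup M] [Module Rᵐᵒᵖ M]

theorem rsmul_balanced (g : N →ₛₗ[RingHom.op i] M) (n : N) (a : A) (s : Via i) :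
    ((rsmul i M).comp g.toAddMonoidHom) (op a • n) s =
      ((rsmul i M).comp g.toAddMonoidHom) n (a • s) := by
  obtain ⟨r, rfl⟩ := (Via.of i).surjective s
  simp only [AddMonoidHom.comp_apply, LinearMap.toAddMonoidHom_coe, map_smulₛₗ, Via.smul_of,
    rsmul_apply, MulOpposite.op_mul, mul_smul]
  rfl

theorem lift_rsmul_tmul (g : N →ₛₗ[RingHom.op i] M) (n : N) (r : R) :
    Tens.lift b ((rsmul i M).comp g.toAddMonoidHom) (Tens.tmul b n (Via.of i r)) = op r • g n :=
  Tens.lift_tmul b _ (rsmul_balanced g) n _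

/-- The linear map out of extended scalars adjoint to a given semilinear one. -/
noncomputable def adjoint (g : N →ₛₗ[RingHom.op i] M) : Tens b N →ₗ[Rᵐᵒᵖ] M :=
  Tens.toLinear R (Tens.lift b ((rsmul i M).comp g.toAddMonoidHom)) fun d n s => by
    obtain ⟨r, rfl⟩ := (Via.of i).surjective s
    simp only [Via.op_smul_of, lift_rsmul_tmul, MulOpposite.op_mul, mul_smul, op_unop]

theorem adjoint_tmul (g : N →ₛₗ[RingHom.op i] M) (n : N) (r : R) :
    adjoint b g (Tens.tmul b n (Via.of i r)) = op r • g n :=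
  lift_rsmul_tmul b g n r

theorem Via.of_eq_smul (r : R) : Via.of i r = op r • Via.of i 1 := by
  rw [Via.op_smul_of, unop_op, one_mul]

variable {b} in
theorem Tens.linearMap_ext {f g : Tens b N →ₗ[Rᵐᵒᵖ] M}
    (h : ∀ n, f (Tens.tmul b n (Via.of i 1)) = g (Tens.tmul b n (Via.of i 1))) : f = g := by
  refine LinearMap.toAddMonoidHom_injective (Tens.addHom_ext_tmul fun n k => ?_)
  obtain ⟨r, hr⟩ := (Via.of i).surjective (b k)
  simp only [LinearMap.toAddMonoidHom_coe, ← hr, Via.of_eq_smul r, ← Tens.smul_tmul, map_smul, h]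

/-- The unit `n ↦ n ⊗ 1` of extension of scalars. -/
noncomputable def Tens.unit : N →ₛₗ[RingHom.op i] Tens b N where
  toFun n := Tens.tmul b n (Via.of i 1)
  map_add' x y := by rw [map_add, AddMonoidHom.add_apply]
  map_smul' a n := by
    obtain ⟨a, rfl⟩ := op_surjective a
    rw [Tens.smul_tmul_left, Via.smul_of, mul_one, Via.of_eq_smul, ← Tens.smul_tmul]
    rfl

end

/-- Restriction of scalars for right modules. -/
noncomputable abbrev restriction (i : A →+* R) : RightMod R ⥤ RightMod A :=
  ModuleCat.restrictScalars (RingHom.op i)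

/-- Extension of scalars is left adjoint to restriction of scalars. -/
noncomputable def extensionAdjunction : extension b ⊣ restriction i :=
  Adjunction.mkOfHomEquiv
    { homEquiv := fun N M =>
        { toFun := fun f =>
            ModuleCat.semilinearMapAddEquiv (RingHom.op i) N M (f.hom.comp (Tens.unit b))
          invFun := fun g => ModuleCat.ofHom
            (adjoint b ((ModuleCat.semilinearMapAddEquiv (RingHom.op i) N M).symm g))
          left_inv := fun f => by
            refine ModuleCat.hom_ext (Tens.linearMap_ext fun n => ?_)
            rw [ModuleCat.hom_ofHom, adjoint_tmul, op_one, one_smul]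
            rfl
          right_inv := fun g => by
            ext n
            refine (adjoint_tmul b _ n 1).trans ?_
            rw [op_one]
            exact one_smul Rᵐᵒᵖ (show M from g n) }
      homEquiv_naturality_left_symm := fun {X' X Y} f g => by
        refine ModuleCat.hom_ext (Tens.linearMap_ext fun n => ?_)
        refine (adjoint_tmul b
          ((ModuleCat.semilinearMapAddEquiv (RingHom.op i) X' Y).symm (f ≫ g)) n 1).trans ?_
        exact ((congrArg (adjoint b ((ModuleCat.semilinearMapAddEquiv (RingHom.op i) X Y).symm g))
          (Tens.mapHom_tmul b f.hom n (Via.of i 1))).trans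
          (adjoint_tmul b ((ModuleCat.semilinearMapAddEquiv (RingHom.op i) X Y).symm g)
            (f n) 1)).symm
      homEquiv_naturality_right := fun f g => rfl }

instance : (extension b).PreservesZeroMorphisms where
  map_zero X Y := by
    refine ModuleCat.hom_ext (LinearMap.toAddMonoidHom_injective
      (Tens.addHom_ext_tmul fun n k => ?_))
    exact (Tens.mapHom_tmul b (0 : X →ₗ[Aᵐᵒᵖ] Y) n (b k)).trans (by simp; rfl)

/-- A left basis makes the extended module a direct sum of copies of `N`, with maps acting
coordinatewise, so exactness is checked in each coordinate. -/
theorem extension_shortExact (E : ShortComplex (RightMod A)) (hE : E.ShortExact) :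
    (E.map (extension b)).ShortExact := by
  refine ModuleCat.shortComplex_shortExact _ (Tens.map_exact b _ _
    ((ShortComplex.ShortExact.moduleCat_exact_iff_function_exact E).1 hE.exact)) ?_ ?_
  · exact Finsupp.mapRange_injective _ (map_zero _) hE.moduleCat_injective_f
  · exact Finsupp.mapRange_surjective _ (map_zero _) hE.moduleCat_surjective_g

/-- An isomorphic copy of `X` is a colimit of the constant diagram at `X` on a one-object category,
which is filtered. -/
theorem IsExactClass.of_iso {P : ObjectProperty (RightMod R)} (hP : IsExactClass P)
    {X Y : RightMod R} (e : X ≅ Y) (hX : P X) : P Y := by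
  refine hP.filtered_colimit PUnit ((Functor.const _).obj X)
    { pt := Y, ι := { app := fun _ => e.hom } } ?_ fun _ => hX
  exact { desc := fun s => e.inv ≫ s.ι.app PUnit.unit
          fac := fun s j => by simp
          uniq := fun s m hm => by simp [← hm PUnit.unit] }

/-- Over a right regular ring `A`, extending scalars to `R` lands in every exact class that
contains `R`, if `R` is free as a left `A`-module. -/
theorem IsRightRegular.extension_mem (hA : IsRightRegular A) {P : ObjectProperty (RightMod R)}
    (hP : IsExactClass P) (hR : P (ModuleCat.of Rᵐᵒᵖ R)) (N : RightMod A) :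
    P ((extension b).obj N) := by
  -- Minimality of the regular modules is applied to the preimage of `P` under extension of scalars.
  refine hA N (fun N => P ((extension b).obj N)) ?_ ?_
  · have := (extensionAdjunction b).leftAdjoint_preservesColimits
    exact
      { filtered_colimit := fun J _ _ F c hc h =>
          hP.filtered_colimit J (F ⋙ extension b) ((extension b).mapCocone c)
            (isColimitOfPreserves _ hc) h
        left := fun E hE => hP.left _ (extension_shortExact b E hE)
        middle := fun E hE => hP.middle _ (extension_shortExact b E hE)
        right := fun E hE => hP.right _ (extension_shortExact b E hE) }
  -- The map `a ⊗ r ↦ i(a) r` adjoint to `i` identifies the extension of `A` with `R`; in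
  -- coordinates it is the inverse of `b.repr`, hence bijective.
  · let g : A →ₛₗ[RingHom.op i] R :=
      { toFun := i
        map_add' := map_add i
        map_smul' := fun a x => map_mul i x a.unop }
    have hg : ∀ x : Tens b A, adjoint b g x = (Via.of i).symm (b.repr.symm x) := by
      intro x
      suffices (adjoint b g).toAddMonoidHom = (Via.of i).symm.toAddMonoidHom.comp
          b.repr.symm.toAddEquiv.toAddMonoidHom from DFunLike.congr_fun this x
      refine Tens.addHom_ext fun k a => ?_
      obtain ⟨r, hr⟩ := (Via.of i).surjective (b k)
      rw [← Tens.tmul_basis, ← hr]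
      refine (adjoint_tmul b g a r).trans ?_
      rw [hr, Tens.tmul_basis]
      refine Eq.trans ?_ (congrArg (Via.of i).symm (b.repr_symm_single k a)).symm
      rw [← hr]
      rfl
    refine hP.of_iso (LinearEquiv.toModuleIso (LinearEquiv.ofBijective (adjoint b g) ?_)).symm hR
    rw [show ⇑(adjoint b g) = (Via.of i).symm ∘ b.repr.symm from funext hg]
    exact (Via.of i).symm.bijective.comp b.repr.symm.bijective

end Functor

/-! ### Closure properties of exact classes -/

section Exactness

variable {R : Type u} [Ring R]

theorem IsExactClass.prod_mem {P : ObjectProperty (RightMod R)} (hP : IsExactClass P)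
    {X Y : Type u} [AddCommGroup X] [AddCommGroup Y] [Module Rᵐᵒᵖ X] [Module Rᵐᵒᵖ Y]
    (hX : P (ModuleCat.of Rᵐᵒᵖ X)) (hY : P (ModuleCat.of Rᵐᵒᵖ Y)) :
    P (ModuleCat.of Rᵐᵒᵖ (X × Y)) :=
  hP.middle (ShortComplex.moduleCatMk (LinearMap.inl Rᵐᵒᵖ X Y) (LinearMap.snd Rᵐᵒᵖ X Y)
      (LinearMap.snd_comp_inl ..))
    (ModuleCat.shortComplex_shortExact _ (Function.Exact.inl_snd (R := Rᵐᵒᵖ) (M := X) (N := Y))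
      (LinearMap.inl_injective (R := Rᵐᵒᵖ) (M := X) (M₂ := Y))
      (LinearMap.snd_surjective (R := Rᵐᵒᵖ) (M := X) (M₂ := Y))) hX hY

/-- A sequence of modules with an additive contraction is exact; so its cokernel lies in every
exact class that contains the two other terms. -/
theorem IsExactClass.mem_of_contraction {P : ObjectProperty (RightMod R)} (hP : IsExactClass P)
    {X Y M : Type u} [AddCommGroup X] [AddCommGroup Y] [AddCommGroup M] [Module Rᵐᵒᵖ X]
    [Module Rᵐᵒᵖ Y] [Module Rᵐᵒᵖ M] (d : X →ₗ[Rᵐᵒᵖ] Y) (e : Y →ₗ[Rᵐᵒᵖ] M) (h : Y →+ X)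
    (s : M →+ Y) (hd : ∀ x, h (d x) = x) (dh : ∀ y, d (h y) + s (e y) = y)
    (es : ∀ m, e (s m) = m)
    (hX : P (ModuleCat.of Rᵐᵒᵖ X)) (hY : P (ModuleCat.of Rᵐᵒᵖ Y)) :
    P (ModuleCat.of Rᵐᵒᵖ M) := by
  -- The contraction identity at `d x` gives `s (e (d x)) = 0`, and `e` undoes `s`.
  have ed : ∀ x, e (d x) = 0 := fun x => by
    have := dh (d x)
    rw [hd, add_eq_left] at this
    rw [← es (e (d x)), this, map_zero]
  refine hP.right (ShortComplex.moduleCatMk d e (LinearMap.ext ed))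
    (ModuleCat.shortComplex_shortExact _ ?_ (Function.LeftInverse.injective hd)
      (Function.RightInverse.surjective es)) hX hY
  intro y
  refine ⟨fun hy => ⟨h y, ?_⟩, ?_⟩
  · have := dh y
    rwa [show e y = 0 from hy, map_zero, add_zero] at this
  · rintro ⟨x, rfl⟩
    exact ed x

end Exactness

/-! ### Bases from pure embeddings, change of coefficient ring, and van der Waerden's trick -/

section Bases

/-- The splitting lets `1` be adjoined to a basis of the complement. The index `none` marks this
trivial letter, so a word may begin with a genuine letter or with none. -/
theorem IsPureEmbeddingLeftFree.exists_basis {C A : Type u} [Ring C] [Ring A] {α : C →+* A}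
    (h : IsPureEmbeddingLeftFree α) :
    ∃ (I : Type u) (a : Module.Basis (Option I) C (Via α)), a none = Via.of α 1 := by
  let _ : Module C A := Module.compHom A α
  obtain ⟨hα, A', -, hc, hf⟩ := h
  let f : C →ₗ[C] A := LinearMap.toSpanSingleton C A 1
  have hfα : ∀ c, f c = α c := fun c => mul_one (α c)
  let v := Module.Free.chooseBasis C A'
  let e : (C × A') ≃ₗ[C] A := LinearEquiv.ofBijective (f.coprod A'.subtype) <| by
    constructor
    · rw [injective_iff_map_eq_zero]
      rintro ⟨c, x⟩ h0
      have h0 : α c + x = 0 := by rw [← hfα]; exact h0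
      have hx : α c ∈ A'.toAddSubgroup := by
        rw [eq_neg_of_add_eq_zero_left h0]
        exact neg_mem x.2
      have hz : α c = 0 := by
        have := hc.disjoint.le_bot ⟨⟨c, rfl⟩, hx⟩
        exact this
      have hc0 : c = 0 := hα (by rw [hz, map_zero])
      rw [hz, zero_add] at h0
      exact Prod.ext hc0 (Subtype.ext h0)
    · intro y
      obtain ⟨z, ⟨c, rfl⟩, x, hx, rfl⟩ := AddSubgroup.mem_sup.1
        (hc.codisjoint.eq_top ▸ AddSubgroup.mem_top y)
      exact ⟨(c, ⟨x, hx⟩), congrArg (· + x) (hfα c)⟩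
  let w : Module.Basis (PUnit.{u + 1} ⊕ Module.Free.ChooseBasisIndex C A') C A :=
    ((Module.Basis.singleton PUnit.{u + 1} C).prod v).map e
  have hw : w (Sum.inl PUnit.unit) = 1 := by
    simp only [w, Module.Basis.map_apply]
    have : ((Module.Basis.singleton PUnit.{u + 1} C).prod v) (Sum.inl PUnit.unit) = (1, 0) := by
      ext <;> simp
    rw [this]
    change f 1 + 0 = 1
    rw [hfα, map_one, add_zero]
  let r : Module.Basis (Option (Module.Free.ChooseBasisIndex C A')) C A :=
    w.reindex ((Equiv.sumComm _ _).trans (Equiv.optionEquivSumPUnit _).symm)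
  exact ⟨_, r, (Module.Basis.reindex_apply (M := A) w _ none).trans hw⟩

variable {A C R ι κ : Type*} [Ring A] [Ring C] [Ring R]

/-- The basis of `R` over `C` obtained from a basis of `A` over `C` and a basis of `R` over `A`. -/
noncomputable def compBasis {α : C →+* A} {i : A →+* R} (a : Module.Basis κ C (Via α))
    (b : Module.Basis ι A (Via i)) : Module.Basis (κ × ι) C (Via (i.comp α)) :=
  letI : Module C A := Module.compHom A α
  letI : Module C (Via i) := Module.compHom (Via i) α
  letI : IsScalarTower C A (Via i) := ⟨fun c x y => mul_smul (α c) x y⟩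
  Module.Basis.smulTower (S := A) (R := C) (A := Via i) a b

theorem compBasis_apply {α : C →+* A} {i : A →+* R} (a : Module.Basis κ C (Via α))
    (b : Module.Basis ι A (Via i)) (k : κ) (l : ι) :
    compBasis a b (k, l) = Via.of (i.comp α) (i ((Via.of α).symm (a k)) *
      (Via.of i).symm (b l)) := by
  let : Module C A := Module.compHom A α
  let : Module C (Via i) := Module.compHom (Via i) α
  let : IsScalarTower C A (Via i) := ⟨fun c x y => mul_smul (α c) x y⟩
  exact Module.Basis.smulTower_apply (S := A) (R := C) (A := Via i) a b (k, l)

/-- A free `A`-module as a free `C`-module. -/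
noncomputable def refine (ι : Type*) {α : C →+* A} (a : Module.Basis κ C (Via α)) :
    (ι →₀ A) ≃+ (ι × κ →₀ C) :=
  (Finsupp.mapRange.addEquiv ((Via.of α).trans a.repr.toAddEquiv)).trans
    Finsupp.curryAddEquiv.symm

theorem refine_symm_single {α : C →+* A} (a : Module.Basis κ C (Via α)) (w : ι) (x : κ) (c : C) :
    (refine ι a).symm (Finsupp.single (w, x) c) =
      Finsupp.single w (α c * (Via.of α).symm (a x)) := by
  have h1 : Finsupp.curryAddEquiv (Finsupp.single (w, x) c) =
      Finsupp.single w (Finsupp.single x c) := Finsupp.curry_single _ _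
  change Finsupp.mapRange.addMonoidHom ((Via.of α).trans a.repr.toAddEquiv).symm.toAddMonoidHom
    (Finsupp.curryAddEquiv (Finsupp.single (w, x) c)) = _
  rw [h1]
  refine (Finsupp.mapRange_single (hf := map_zero _)).trans (congrArg _ ?_)
  exact congrArg (Via.of α).symm (a.repr_symm_single x c)

section Transfer

variable {B ι' κ' : Type*} [Ring B] {α : C →+* A} {β : C →+* B} (a : Module.Basis κ C (Via α))
  (b : Module.Basis κ' C (Via β)) (σ : ι × κ ≃ ι' × κ')

theorem finsupp_addHom_ext_basis {X : Type*} [AddCommGroup X] {f g : (ι →₀ A) →+ X}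
    (h : ∀ w x c, f (Finsupp.single w (α c * (Via.of α).symm (a x))) =
      g (Finsupp.single w (α c * (Via.of α).symm (a x)))) : f = g := by
  have : f.comp (refine ι a).symm.toAddMonoidHom = g.comp (refine ι a).symm.toAddMonoidHom := by
    refine Finsupp.addHom_ext fun ⟨w, x⟩ c => ?_
    simpa [refine_symm_single] using h w x c
  ext1 w
  ext y
  simpa using DFunLike.congr_fun this (refine ι a (Finsupp.single w y))

/-- The identification of a free `A`-module with a free `B`-module that matches their bases
over `C`. -/
noncomputable def transfer : (ι →₀ A) ≃+ (ι' →₀ B) :=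
  ((refine ι a).trans (Finsupp.domCongr σ)).trans (refine ι' b).symm

theorem transfer_single {w : ι} {x : κ} {w' : ι'} {y : κ'} (h : σ (w, x) = (w', y)) (c : C) :
    transfer a b σ (Finsupp.single w (α c * (Via.of α).symm (a x))) =
      Finsupp.single w' (β c * (Via.of β).symm (b y)) := by
  rw [← refine_symm_single, ← refine_symm_single, transfer, AddEquiv.trans_apply,
    AddEquiv.trans_apply, AddEquiv.apply_symm_apply, ← h]
  congr 1
  exact Finsupp.equivMapDomain_single _ _ _

/-- Both sides are free over `C` on matched bases. This compatibility is exactly the relation over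
`C` that the universal properties of free products and Laurent extensions demand of an action on
words. -/
theorem transfer_smul (c : C) (x : ι →₀ A) :
    transfer a b σ (α c • x) = β c • transfer a b σ x := by
  suffices (transfer a b σ).toAddMonoidHom.comp (DistribSMul.toAddMonoidHom (ι →₀ A) (α c)) =
      (DistribSMul.toAddMonoidHom (ι' →₀ B) (β c)).comp (transfer a b σ).toAddMonoidHom from
    DFunLike.congr_fun this x
  refine finsupp_addHom_ext_basis a fun w x c' => ?_
  simp only [AddMonoidHom.comp_apply, DistribSMul.toAddMonoidHom_apply, Finsupp.smul_single,
    smul_eq_mul, ← mul_assoc, ← map_mul, AddEquiv.toAddMonoidHom_eq_coe, AddMonoidHom.coe_coe,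
    transfer_single a b σ (Prod.mk.eta (p := σ (w, x))).symm]

end Transfer

section Action

/-- Left multiplication by `A` on words with values in `R`. -/
noncomputable def wordEval (i : A →+* R) (v : ι → R) : (ι →₀ A) →+ R :=
  Finsupp.liftAddHom fun k => (AddMonoidHom.mulRight (v k)).comp i.toAddMonoidHom

@[simp] theorem wordEval_single (i : A →+* R) (v : ι → R) (k : ι) (a : A) :
    wordEval i v (Finsupp.single k a) = i a * v k :=
  Finsupp.liftAddHom_apply_single _ _ _

theorem wordEval_smul (i : A →+* R) (v : ι → R) (a : A) (x : ι →₀ A) :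
    wordEval i v (a • x) = i a * wordEval i v x := by
  induction x using Finsupp.induction_linear with
  | zero => simp
  | add x y hx hy => simp only [smul_add, map_add, hx, hy, mul_add]
  | single k c => rw [Finsupp.smul_single, smul_eq_mul, wordEval_single, wordEval_single, map_mul,
      mul_assoc]

/-- The elements of `R` whose given action on words agrees with multiplication in `R`. -/
def evalSubring {X : Type*} [AddCommGroup X] (h : R →+* AddMonoid.End X) (φ : X →+ R) :
    Subring R where
  carrier := {r | ∀ x, φ (h r x) = r * φ x}
  mul_mem' {r s} hr hs x := by
    rw [map_mul, AddMonoid.End.coe_mul, Function.comp_apply, hr, hs, mul_assoc]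
  one_mem' x := by simp
  add_mem' {r s} hr hs x := by
    rw [add_mul, ← hr, ← hs, ← map_add, map_add h]
    rfl
  zero_mem' x := by simp
  neg_mem' {r} hr x := by
    rw [neg_mul, ← hr, ← map_neg, map_neg h]
    rfl

/-- A left basis of `R` over `A`, from an action of `R` on a free `A`-module that is simply
transitive on the candidate basis. -/
theorem exists_basis_of_action {i : A →+* R} (v : ι → R) (h : R →+* AddMonoid.End (ι →₀ A))
    (hA : ∀ a x, h (i a) x = a • x) (hφ : evalSubring h (wordEval i v) = ⊤) (k₀ : ι)
    (hk₀ : v k₀ = 1) (hv : ∀ k, h (v k) (Finsupp.single k₀ 1) = Finsupp.single k 1) :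
    ∃ b : Module.Basis ι A (Via i), ∀ k, b k = Via.of i (v k) := by
  -- Acting on the base word is a left inverse of evaluation, giving independence; that evaluation
  -- intertwines the action with multiplication gives spanning.
  have hb : ∀ x, h (wordEval i v x) (Finsupp.single k₀ 1) = x := by
    intro x
    induction x using Finsupp.induction_linear with
    | zero => simp
    | add x y hx hy =>
      rw [map_add, map_add]
      exact congrArg₂ (· + ·) hx hy
    | single k a =>
      rw [wordEval_single, map_mul, AddMonoid.End.coe_mul, Function.comp_apply, hv, hA]
      simp
  let f : (ι →₀ A) →ₗ[A] Via i :=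
    { toFun := fun x => Via.of i (wordEval i v x)
      map_add' := fun x y => by rw [map_add, map_add]
      map_smul' := fun a x => by rw [wordEval_smul]; rfl }
  have hf : Function.Bijective (wordEval i v) := by
    refine ⟨Function.LeftInverse.injective (g := fun r => h r (Finsupp.single k₀ 1)) hb,
      fun r => ⟨h r (Finsupp.single k₀ 1), ?_⟩⟩
    have : r ∈ evalSubring h (wordEval i v) := hφ ▸ Subring.mem_top _
    exact (this _).trans (by rw [wordEval_single, hk₀, map_one, mul_one, mul_one])
  refine ⟨Module.Basis.ofRepr (LinearEquiv.ofBijective f hf).symm, fun k => ?_⟩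
  change f (Finsupp.single k 1) = _
  exact congrArg (Via.of i) (by rw [wordEval_single, map_one, one_mul])

end Action

end Bases

/-! ### Modules restricted along a ring homomorphism -/

section Restricted

variable {A R M : Type*} [Ring A] [Ring R] [AddCommGroup M] [Module Aᵐᵒᵖ M] [Module Rᵐᵒᵖ M]
  {i : A →+* R} {ι : Type*} (b : Module.Basis ι A (Via i))

/-- Balancing over `A`, phrased through the `R`-action alone. This is the move that slides a letter
across the tensor sign in each telescoping argument. -/
theorem Tens.tmul_map_mul (hM : ∀ (a : A) (m : M), op a • m = op (i a) • m) (m : M) (a : A)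
    (r : R) : Tens.tmul b m (Via.of i (i a * r)) = Tens.tmul b (op (i a) • m) (Via.of i r) := by
  rw [← hM, Tens.smul_tmul_left, Via.smul_of]

/-- The identity of `M` as a semilinear map along `i`. -/
def semilinearId (hM : ∀ (a : A) (m : M), op a • m = op (i a) • m) : M →ₛₗ[RingHom.op i] M where
  toFun m := m
  map_add' _ _ := rfl
  map_smul' a m := hM a.unop m

end Restricted

/-! ### Free products: alternating words and the Mayer-Vietoris sequence -/

section FreeProduct

/-- Alternating words in `I` and `J`; the word is empty or starts with a letter of `I` or of `J`,
according to the index. -/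
inductive AltWord (I J : Type u) : Bool → Type u
  | nil (s : Bool) : AltWord I J s
  | consI (x : I) (w : AltWord I J false) : AltWord I J true
  | consJ (y : J) (w : AltWord I J true) : AltWord I J false

namespace AltWord

variable {I J : Type u}

/-- Moving a first letter between the two components. -/
def moveRight : AltWord I J false × Option I → AltWord I J true × Option J
  | (w, some x) => (consI x w, none)
  | (nil _, none) => (nil _, none)
  | (consJ y w, none) => (w, some y)

/-- The inverse of `moveRight`. -/
def moveLeft : AltWord I J true × Option J → AltWord I J false × Option I
  | (w, some y) => (consJ y w, none)
  | (nil _, none) => (nil _, none)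
  | (consI x w, none) => (w, some x)

/-- The two descriptions of all alternating words. -/
def moveEquiv : AltWord I J false × Option I ≃ AltWord I J true × Option J where
  toFun := moveRight
  invFun := moveLeft
  left_inv := by
    rintro ⟨w, _ | x⟩
    · cases w <;> rfl
    · rfl
  right_inv := by
    rintro ⟨w, _ | x⟩
    · cases w <;> rfl
    · rfl

variable {R : Type*} [Ring R]

/-- The product of the letters of a word. -/
def val (p : I → R) (q : J → R) : (s : Bool) → AltWord I J s → R
  | _, nil _ => 1
  | _, consI x w => p x * val p q _ w
  | _, consJ y w => q y * val p q _ w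

variable {M T : Type*} [AddCommGroup M] [AddCommGroup T] [Module Rᵐᵒᵖ M]

/-- The values on words of the contraction of the Mayer-Vietoris sequence. -/
def contraction (p : I → R) (q : J → R) (t : R → M →+ T) : (s : Bool) → AltWord I J s → M →+ T
  | false, nil _ => t 1
  | true, nil _ => 0
  | _, consI x w => (contraction p q t _ w).comp (DistribSMul.toAddMonoidHom M (op (p x))) -
      t (p x * val p q _ w)
  | _, consJ y w => (contraction p q t _ w).comp (DistribSMul.toAddMonoidHom M (op (q y))) +
      t (q y * val p q _ w)

end AltWord

/-- Conjugation of additive endomorphisms by an isomorphism. -/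
def conjEnd {X Y : Type*} [AddCommGroup X] [AddCommGroup Y] (θ : X ≃+ Y) :
    AddMonoid.End Y →+* AddMonoid.End X where
  toFun f := θ.symm.toAddMonoidHom.comp (AddMonoidHom.comp f θ.toAddMonoidHom)
  map_one' := by ext x; exact θ.symm_apply_apply x
  map_mul' f g := by
    ext x
    exact congrArg (fun y => θ.symm (f y)) (θ.apply_symm_apply _).symm
  map_zero' := by ext x; exact map_zero θ.symm
  map_add' f g := by ext x; exact map_add θ.symm _ _

theorem prod_addHom_ext {X Y Z : Type*} [AddCommGroup X] [AddCommGroup Y] [AddCommGroup Z]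
    {f g : X × Y →+ Z} (h₁ : f.comp (AddMonoidHom.inl X Y) = g.comp (AddMonoidHom.inl X Y))
    (h₂ : f.comp (AddMonoidHom.inr X Y) = g.comp (AddMonoidHom.inr X Y)) : f = g := by
  rw [← AddMonoidHom.coprod_unique f, ← AddMonoidHom.coprod_unique g, h₁, h₂]

namespace IsFreeProduct

variable {C A B R : Type u} [Ring C] [Ring A] [Ring B] [Ring R] {α : C →+* A} {β : C →+* B}
  {i : A →+* R} {j : B →+* R}

theorem comm (hR : IsFreeProduct α β i j) (c : C) : i (α c) = j (β c) := by
  have := congrArg RingCat.Hom.hom hR.w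
  exact DFunLike.congr_fun this c

theorem exists_lift (hR : IsFreeProduct α β i j) {T : Type u} [Ring T] (f : A →+* T) (g : B →+* T)
    (h : ∀ c, f (α c) = g (β c)) :
    ∃ k : R →+* T, (∀ a, k (i a) = f a) ∧ ∀ b, k (j b) = g b := by
  have h' : RingCat.ofHom α ≫ RingCat.ofHom f = RingCat.ofHom β ≫ RingCat.ofHom g :=
    RingCat.hom_ext (RingHom.ext h)
  refine ⟨(IsPushout.desc hR _ _ h').hom, fun a => ?_, fun b => ?_⟩
  · exact DFunLike.congr_fun (congrArg RingCat.Hom.hom (IsPushout.inl_desc hR _ _ h')) a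
  · exact DFunLike.congr_fun (congrArg RingCat.Hom.hom (IsPushout.inr_desc hR _ _ h')) b

/-- The universal property lifts the generators into `S`, and by uniqueness the lift followed by the
inclusion is the identity. With `S` an `evalSubring`, an action on words need be compared with
multiplication only on generators. -/
theorem subring_eq_top (hR : IsFreeProduct α β i j) (S : Subring R) (hi : ∀ a, i a ∈ S)
    (hj : ∀ b, j b ∈ S) : S = ⊤ := by
  obtain ⟨k, hk, hk'⟩ := hR.exists_lift (i.codRestrict S hi) (j.codRestrict S hj)
    fun c => Subtype.ext (hR.comm c)
  have : RingCat.ofHom (S.subtype.comp k) = 𝟙 (RingCat.of R) := by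
    refine IsPushout.hom_ext hR ?_ ?_
    · exact RingCat.hom_ext (RingHom.ext fun a => congrArg Subtype.val (hk a))
    · exact RingCat.hom_ext (RingHom.ext fun b => congrArg Subtype.val (hk' b))
  refine eq_top_iff.2 fun r _ => ?_
  have hr : (k r : R) = r := DFunLike.congr_fun (congrArg RingCat.Hom.hom this) r
  exact hr ▸ (k r).2

variable {I J : Type u}

/-- The normal form theorem for amalgamated products. -/
theorem exists_bases (hR : IsFreeProduct α β i j) (a : Module.Basis (Option I) C (Via α))
    (ha : a none = Via.of α 1) (b : Module.Basis (Option J) C (Via β))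
    (hb : b none = Via.of β 1) (p : I → R) (hp : ∀ x, p x = i ((Via.of α).symm (a (some x))))
    (q : J → R) (hq : ∀ y, q y = j ((Via.of β).symm (b (some y)))) :
    (∃ v : Module.Basis (AltWord I J false) A (Via i), ∀ w, v w = Via.of i (w.val p q)) ∧
      ∃ v : Module.Basis (AltWord I J true) B (Via j), ∀ w, v w = Via.of j (w.val p q) := by
  let θ : (AltWord I J false →₀ A) ≃+ (AltWord I J true →₀ B) := transfer a b AltWord.moveEquiv
  have hθ : ∀ {w x w' y}, AltWord.moveRight (w, x) = (w', y) → ∀ c,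
      θ (Finsupp.single w (α c * (Via.of α).symm (a x))) =
        Finsupp.single w' (β c * (Via.of β).symm (b y)) :=
    fun h c => transfer_single a b AltWord.moveEquiv h c
  have ha' : (Via.of α).symm (a none) = 1 := by rw [ha, AddEquiv.symm_apply_apply]
  have hb' : (Via.of β).symm (b none) = 1 := by rw [hb, AddEquiv.symm_apply_apply]
  -- One additive group carries both actions: `A` acts on its free module on words not starting in
  -- `I`, and `B` acts through `θ` on its free module on words not starting in `J`.
  obtain ⟨h, hA, hB⟩ := hR.exists_lift (Module.toAddMonoidEnd A (AltWord I J false →₀ A))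
    ((conjEnd θ).comp (Module.toAddMonoidEnd B (AltWord I J true →₀ B))) fun c => by
      ext1 x
      change α c • x = θ.symm (β c • θ x)
      rw [← transfer_smul, AddEquiv.symm_apply_apply]
  replace hA : ∀ a x, h (i a) x = a • x := fun a x => DFunLike.congr_fun (hA a) x
  replace hB : ∀ b x, h (j b) x = θ.symm (b • θ x) := fun b x => DFunLike.congr_fun (hB b) x
  let φ := wordEval i (AltWord.val (I := I) (J := J) p q false)
  let ψ := wordEval j (AltWord.val (I := I) (J := J) p q true)
  -- The value in `R` does not depend on whether a leading letter is kept in the word or absorbed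
  -- into the coefficient.
  have hφψ : ∀ x, ψ (θ x) = φ x := by
    intro x
    suffices ψ.comp θ.toAddMonoidHom = φ from DFunLike.congr_fun this x
    refine finsupp_addHom_ext_basis a fun w x c => ?_
    change ψ (θ _) = _
    rcases x with _ | x
    · cases w with
      | nil =>
        rw [hθ (w' := AltWord.nil _) (y := none) rfl, wordEval_single, wordEval_single, ha', hb']
        simp [AltWord.val, hR.comm]
      | consJ y w =>
        rw [hθ (w' := w) (y := some y) rfl, wordEval_single, wordEval_single, ha']
        simp [AltWord.val, hR.comm, hq, mul_assoc]
    · rw [hθ (w' := AltWord.consI x w) (y := none) rfl, wordEval_single, wordEval_single, hb']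
      simp [AltWord.val, ← hR.comm, hp, mul_assoc]
  have hφ : evalSubring h φ = ⊤ := by
    refine hR.subring_eq_top _ (fun a => ?_) fun b => ?_
    · intro x
      rw [hA, wordEval_smul]
    · intro x
      rw [hB, ← hφψ, AddEquiv.apply_symm_apply, wordEval_smul, hφψ]
  let e : AltWord I J false →₀ A := Finsupp.single (AltWord.nil _) 1
  have he : θ e = Finsupp.single (AltWord.nil _) 1 := by
    have := hθ (w := AltWord.nil _) (x := none) (w' := AltWord.nil _) (y := none) rfl 1
    simpa [ha', hb'] using this
  -- Tails of a word alternate between the two types, so the induction must follow basis vectors of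
  -- both modules at once, those over `B` pulled back by `θ`.
  let vec : (s : Bool) → AltWord I J s → (AltWord I J false →₀ A) := fun s => match s with
    | false => fun w => Finsupp.single w 1
    | true => fun w => θ.symm (Finsupp.single w 1)
  have hvec : ∀ (s : Bool) (w : AltWord I J s), h (w.val p q) e = vec s w := by
    intro s w
    induction w with
    | nil s =>
      rw [AltWord.val, map_one]
      cases s
      · rfl
      · exact (θ.symm_apply_eq.2 he.symm).symm
    | consI x w ih =>
      rw [AltWord.val, map_mul, AddMonoid.End.coe_mul, Function.comp_apply, ih, hp, hA]
      refine (θ.symm_apply_eq.2 ?_).symm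
      have := hθ (w := w) (x := some x) (w' := AltWord.consI x w) (y := none) rfl 1
      simp only [map_one, one_mul, hb'] at this
      rw [← this, Finsupp.smul_single, smul_eq_mul, mul_one]
    | consJ y w ih =>
      rw [AltWord.val, map_mul, AddMonoid.End.coe_mul, Function.comp_apply, ih, hq, hB]
      refine θ.symm_apply_eq.2 ?_
      have := hθ (w := AltWord.consJ y w) (x := none) (w' := w) (y := some y) rfl 1
      simp only [map_one, one_mul, ha'] at this
      change _ • θ (θ.symm _) = θ (Finsupp.single _ 1)
      rw [this, AddEquiv.apply_symm_apply, Finsupp.smul_single, smul_eq_mul, mul_one]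
  constructor
  · exact exists_basis_of_action _ h hA hφ (AltWord.nil _) rfl (hvec false)
  · refine exists_basis_of_action _ ((conjEnd θ.symm).comp h) ?_ ?_ (AltWord.nil _) rfl fun w => ?_
    · intro b y
      change θ (h (j b) (θ.symm y)) = b • y
      rw [hB, AddEquiv.apply_symm_apply, AddEquiv.apply_symm_apply]
    · refine eq_top_iff.2 fun r hr y => ?_
      change ψ (θ (h r (θ.symm y))) = r * ψ y
      have hr' : r ∈ evalSubring h φ := hφ ▸ hr
      rw [hφψ, hr', ← hφψ, AddEquiv.apply_symm_apply]
    · change θ (h _ (θ.symm _)) = _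
      rw [← he, AddEquiv.symm_apply_apply, hvec true w]
      exact AddEquiv.apply_symm_apply _ _

/-- The Mayer-Vietoris sequence of an amalgamated product. -/
theorem mem_of_tens_mem (hR : IsFreeProduct α β i j) (a : Module.Basis (Option I) C (Via α))
    (ha : a none = Via.of α 1) (b : Module.Basis (Option J) C (Via β))
    (hb : b none = Via.of β 1)
    {P : ObjectProperty (RightMod R)} (hP : IsExactClass P) {M : Type u} [AddCommGroup M]
    [Module Rᵐᵒᵖ M] [Module Aᵐᵒᵖ M] [Module Bᵐᵒᵖ M] [Module Cᵐᵒᵖ M]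
    (hMA : ∀ (a : A) (m : M), op a • m = op (i a) • m)
    (hMB : ∀ (b : B) (m : M), op b • m = op (j b) • m)
    (hMC : ∀ (c : C) (m : M), op c • m = op (i (α c)) • m)
    (hA : ∀ v : Module.Basis (AltWord I J false) A (Via i), P (ModuleCat.of Rᵐᵒᵖ (Tens v M)))
    (hB : ∀ v : Module.Basis (AltWord I J true) B (Via j), P (ModuleCat.of Rᵐᵒᵖ (Tens v M)))
    (hC : ∀ v : Module.Basis (Option I × AltWord I J false) C (Via (i.comp α)),
      P (ModuleCat.of Rᵐᵒᵖ (Tens v M))) :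
    P (ModuleCat.of Rᵐᵒᵖ M) := by
  let p : I → R := fun x => i ((Via.of α).symm (a (some x)))
  let q : J → R := fun y => j ((Via.of β).symm (b (some y)))
  obtain ⟨⟨vA, hvA⟩, vB, hvB⟩ := hR.exists_bases a ha b hb p (fun _ => rfl) q fun _ => rfl
  let vC := compBasis a vA
  have hvC : ∀ x w, vC (some x, w) = Via.of _ (p x * w.val p q) := fun x w => by
    rw [compBasis_apply, hvA, AddEquiv.symm_apply_apply]
  have hvC' : ∀ w, vC (none, w) = Via.of _ (w.val p q) := fun w => by
    rw [compBasis_apply, hvA, ha, AddEquiv.symm_apply_apply, AddEquiv.symm_apply_apply, map_one,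
      one_mul]
  let tA : M → R → Tens vA M := fun m r => Tens.tmul vA m (Via.of i r)
  let tB : M → R → Tens vB M := fun m r => Tens.tmul vB m (Via.of j r)
  let tC : M → R → Tens vC M := fun m r => Tens.tmul vC m (Via.of (i.comp α) r)
  have tA_mul : ∀ m x r, tA m (p x * r) = tA (op (p x) • m) r := fun m x r =>
    Tens.tmul_map_mul vA hMA m _ r
  have tB_mul : ∀ m y r, tB m (q y * r) = tB (op (q y) • m) r := fun m y r =>
    Tens.tmul_map_mul vB hMB m _ r
  let gA : M →ₛₗ[RingHom.op (i.comp α)] Tens vA M :=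
    { toFun := fun m => tA m 1
      map_add' := fun x y => by simp [tA]
      map_smul' := fun c m => by
        change tA (op c.unop • m) 1 = op (i (α c.unop)) • tA m 1
        rw [hMC]
        change Tens.tmul vA _ _ = op (i (α c.unop)) • Tens.tmul vA _ _
        rw [← Tens.tmul_map_mul vA hMA, mul_one, Via.of_eq_smul, ← Tens.smul_tmul] }
  let gB : M →ₛₗ[RingHom.op (i.comp α)] Tens vB M :=
    { toFun := fun m => tB m 1
      map_add' := fun x y => by simp [tB]
      map_smul' := fun c m => by
        change tB (op c.unop • m) 1 = op (i (α c.unop)) • tB m 1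
        rw [hMC, hR.comm]
        change Tens.tmul vB _ _ = op (j (β c.unop)) • Tens.tmul vB _ _
        rw [← Tens.tmul_map_mul vB hMB, mul_one, Via.of_eq_smul, ← Tens.smul_tmul] }
  -- The map is `m ⊗ r ↦ (m ⊗ r, -m ⊗ r)`.
  let d : Tens vC M →ₗ[Rᵐᵒᵖ] Tens vA M × Tens vB M := (adjoint vC gA).prod (-adjoint vC gB)
  have hd : ∀ m r, d (tC m r) = (tA m r, -tB m r) := fun m r => by
    change (adjoint vC gA _, -adjoint vC gB _) = _
    rw [adjoint_tmul, adjoint_tmul]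
    change (op r • Tens.tmul vA _ _, -(op r • Tens.tmul vB _ _)) = _
    rw [Tens.smul_tmul, Tens.smul_tmul, ← Via.of_eq_smul, ← Via.of_eq_smul]
  let ε : Tens vA M × Tens vB M →ₗ[Rᵐᵒᵖ] M :=
    (adjoint vA (semilinearId hMA)).coprod (adjoint vB (semilinearId hMB))
  have hεA : ∀ m r, ε (tA m r, 0) = op r • m := fun m r => by
    change adjoint vA (semilinearId hMA) (Tens.tmul vA m (Via.of i r)) +
      adjoint vB (semilinearId hMB) 0 = _
    rw [map_zero, add_zero, adjoint_tmul]
    rfl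
  have hεB : ∀ m r, ε (0, tB m r) = op r • m := fun m r => by
    change adjoint vA (semilinearId hMA) 0 +
      adjoint vB (semilinearId hMB) (Tens.tmul vB m (Via.of j r)) = _
    rw [map_zero, zero_add, adjoint_tmul]
    rfl
  let k := AltWord.contraction (I := I) (J := J) p q fun r =>
    (Tens.tmul vC : M →+ _).flip (Via.of (i.comp α) r)
  let kA : Tens vA M →+ Tens vC M := Tens.extend vA (k false)
  let kB : Tens vB M →+ Tens vC M := Tens.extend vB (k true)
  have hkA : ∀ m w, kA (tA m (w.val p q)) = k _ w m := fun m w => by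
    change Tens.extend vA (k false) (Tens.tmul vA m _) = _
    rw [← hvA, Tens.tmul_basis, Tens.extend_single]
  have hkB : ∀ m w, kB (tB m (w.val p q)) = k _ w m := fun m w => by
    change Tens.extend vB (k true) (Tens.tmul vB m _) = _
    rw [← hvB, Tens.tmul_basis, Tens.extend_single]
  have hkI : ∀ x w m, k _ (AltWord.consI x w) m = k _ w (op (p x) • m) - tC m (p x * w.val p q) :=
    fun x w m => rfl
  have hkJ : ∀ y w m, k _ (AltWord.consJ y w) m = k _ w (op (q y) • m) + tC m (q y * w.val p q) :=
    fun x w m => rfl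
  -- The section uses the `B`-summand. This forces the asymmetric values of the contraction on empty
  -- words: `0` over `B`, and over `A` the element `m ⊗ 1`, whose boundary `(m ⊗ 1, -m ⊗ 1)` moves
  -- the section to the `A`-summand.
  let s : M →+ Tens vA M × Tens vB M :=
    (AddMonoidHom.inr _ _).comp ((Tens.tmul vB : M →+ _).flip (Via.of j 1))
  have hs : ∀ m, s m = (0, tB m 1) := fun m => rfl
  refine hP.mem_of_contraction d ε (kA.coprod kB) s ?_ ?_ ?_ (hC vC) (hP.prod_mem (hA vA) (hB vB))
  · intro x
    suffices (kA.coprod kB).comp d.toAddMonoidHom = AddMonoidHom.id _ from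
      DFunLike.congr_fun this x
    refine Tens.addHom_ext_tmul fun m l => ?_
    rcases l with ⟨_ | x, w⟩
    · rw [hvC']
      change (kA.coprod kB) (d (tC m _)) = tC m _
      rw [hd, AddMonoidHom.coprod_apply, map_neg, hkA]
      cases w with
      | nil =>
        change tC m 1 + -kB (tB m (AltWord.val p q true (AltWord.nil true))) = _
        rw [hkB]
        change tC m 1 + -0 = tC m 1
        rw [neg_zero, add_zero]
      | consJ y w =>
        rw [hkJ, AltWord.val, tB_mul, hkB]
        abel
    · rw [hvC]
      change (kA.coprod kB) (d (tC m _)) = tC m _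
      rw [hd, AddMonoidHom.coprod_apply, map_neg, tA_mul, hkA,
        show tB m (p x * w.val p q) = tB m (AltWord.val p q _ (AltWord.consI x w)) from rfl, hkB,
        hkI]
      abel
  · let vec : (s : Bool) → M → R → (Tens vA M × Tens vB M) := fun s => match s with
      | false => fun m r => (tA m r, 0)
      | true => fun m r => (0, tB m r)
    -- Removing a letter of `I` replaces `m ⊗ xw` by `mx ⊗ w` over `A`, while the boundary term
    -- corrects the switch from `B` to `A`; letters of `J` are symmetric. Hence `m` must stay
    -- general in the induction.
    have key : ∀ (σ : Bool) (w : AltWord I J σ) (m : M),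
        d (k _ w m) + s (op (w.val p q) • m) = vec σ m (w.val p q) := by
      intro σ w
      induction w with
      | nil σ =>
        intro m
        rw [AltWord.val, op_one, one_smul, hs]
        cases σ
        · change d (tC m 1) + _ = (tA m 1, 0)
          rw [hd]
          simp
        · change d 0 + _ = (0, tB m 1)
          rw [map_zero, zero_add]
      | consI x w ih =>
        intro m
        have := ih (op (p x) • m)
        rw [hkI, map_sub, hd, AltWord.val, MulOpposite.op_mul, mul_smul, sub_add_eq_add_sub, this]
        change (tA _ _, 0) - (_, _) = (0, tB _ _)
        rw [tA_mul]
        simp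
      | consJ y w ih =>
        intro m
        have := ih (op (q y) • m)
        rw [hkJ, map_add, hd, AltWord.val, MulOpposite.op_mul, mul_smul, add_right_comm, this]
        change (0, tB _ _) + (_, _) = (tA _ _, 0)
        rw [tB_mul]
        simp
    intro y
    suffices d.toAddMonoidHom.comp (kA.coprod kB) + s.comp ε.toAddMonoidHom =
      AddMonoidHom.id _ from DFunLike.congr_fun this y
    refine prod_addHom_ext (Tens.addHom_ext_tmul fun m w => ?_)
      (Tens.addHom_ext_tmul fun m w => ?_)
    · rw [hvA]
      change d ((kA.coprod kB) (tA m _, 0)) + s (ε (tA m _, 0)) = (tA m _, 0)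
      rw [AddMonoidHom.coprod_apply, map_zero, add_zero, hkA, hεA]
      exact key _ w m
    · rw [hvB]
      change d ((kA.coprod kB) (0, tB m _)) + s (ε (0, tB m _)) = (0, tB m _)
      rw [AddMonoidHom.coprod_apply, map_zero, zero_add, hkB, hεB]
      exact key _ w m
  · intro m
    rw [hs, hεB, op_one, one_smul]

theorem isRightRegular (hR : IsFreeProduct α β i j) (hα : IsPureEmbeddingLeftFree α)
    (hβ : IsPureEmbeddingLeftFree β) (hC : IsRightRegular C) (hA : IsRightRegular A)
    (hB : IsRightRegular B) : IsRightRegular R := by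
  intro M P hP hPR
  obtain ⟨I, a, ha⟩ := hα.exists_basis
  obtain ⟨J, b, hb⟩ := hβ.exists_basis
  let _ : Module Aᵐᵒᵖ M := Module.compHom M (RingHom.op i)
  let _ : Module Bᵐᵒᵖ M := Module.compHom M (RingHom.op j)
  let _ : Module Cᵐᵒᵖ M := Module.compHom M (RingHom.op (i.comp α))
  exact hR.mem_of_tens_mem a ha b hb hP (fun _ _ => rfl) (fun _ _ => rfl) (fun _ _ => rfl)
    (fun v => hA.extension_mem v hP hPR (ModuleCat.of Aᵐᵒᵖ M))
    (fun v => hB.extension_mem v hP hPR (ModuleCat.of Bᵐᵒᵖ M))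
    fun v => hC.extension_mem v hP hPR (ModuleCat.of Cᵐᵒᵖ M)

end IsFreeProduct

end FreeProduct

/-! ### Tensor algebras: words in a basis and the resolution of length one -/

section TensorAlgebra

variable {I : Type u} {R M T : Type*} [Ring R] [AddCommGroup M] [AddCommGroup T] [Module Rᵐᵒᵖ M]

/-- The values on words of the contraction of the resolution over a tensor algebra. -/
def listContraction (p : I → R) (t : I → R → M →+ T) : List I → M →+ T
  | [] => 0
  | x :: w => t x (w.map p).prod +
      (listContraction p t w).comp (DistribSMul.toAddMonoidHom M (op (p x)))

namespace IsTensorAlgebra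

variable {C S R : Type u} [Ring C] [AddCommGroup S] [Module C S] [Module Cᵐᵒᵖ S]
  [SMulCommClass C Cᵐᵒᵖ S] [Ring R] {i : C →+* R} {j : S →+ R}

omit [SMulCommClass C Cᵐᵒᵖ S] in
theorem subring_eq_top (hR : IsTensorAlgebra i j) (U : Subring R) (hi : ∀ c, i c ∈ U)
    (hj : ∀ s, j s ∈ U) : U = ⊤ := by
  obtain ⟨k, ⟨hk, hk'⟩, -⟩ := hR.existsUnique_lift U (i.codRestrict U hi)
    (j.codRestrict U.toAddSubgroup hj)
    (fun c x => Subtype.ext (hR.map_left c x)) fun c x => Subtype.ext (hR.map_right c x)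
  have : U.subtype.comp k = RingHom.id R :=
    (hR.existsUnique_lift R i j hR.map_left hR.map_right).unique
      ⟨RingHom.ext fun c => congrArg Subtype.val (DFunLike.congr_fun hk c),
        fun x => congrArg Subtype.val (hk' x)⟩ ⟨rfl, fun _ => rfl⟩
  refine eq_top_iff.2 fun r _ => ?_
  have hr : (k r : R) = r := DFunLike.congr_fun this r
  exact hr ▸ (k r).2

/-- The action of `S` on words with coefficients in `C`. -/
noncomputable def consAction (v : Module.Basis I C S) : S →+ AddMonoid.End (List I →₀ C) :=
  AddMonoidHom.mk' (fun s => Finsupp.liftAddHom fun w =>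
      AddMonoidHom.mk' (fun c => Finsupp.mapDomain (· :: w) (v.repr (op c • s))) fun c c' => by
        rw [MulOpposite.op_add, add_smul, map_add, Finsupp.mapDomain_add]) fun s s' => by
    refine Finsupp.addHom_ext fun w c => ?_
    refine (Finsupp.liftAddHom_apply_single _ _ _).trans ?_
    rw [AddMonoidHom.add_apply, Finsupp.liftAddHom_apply_single, Finsupp.liftAddHom_apply_single]
    simp only [AddMonoidHom.mk'_apply, smul_add, map_add, Finsupp.mapDomain_add]

omit [SMulCommClass C Cᵐᵒᵖ S] in
theorem consAction_single (v : Module.Basis I C S) (s : S) (w : List I) (c : C) :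
    consAction v s (Finsupp.single w c) = Finsupp.mapDomain (· :: w) (v.repr (op c • s)) :=
  Finsupp.liftAddHom_apply_single _ _ _

/-- The normal form theorem for tensor algebras. -/
theorem exists_basis (hR : IsTensorAlgebra i j) (v : Module.Basis I C S) :
    ∃ b : Module.Basis (List I) C (Via i),
      ∀ w, b w = Via.of i (w.map fun x => j (v x)).prod := by
  -- An element `s` sends `c · w` to the expansion of `sc` in the basis `v`, with each basis letter
  -- put in front of `w`. The bimodule law gives left linearity.
  obtain ⟨h, ⟨hC, hS⟩, -⟩ := hR.existsUnique_lift (AddMonoid.End (List I →₀ C))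
    (Module.toAddMonoidEnd C (List I →₀ C)) (consAction v)
    (fun c s => by
      refine Finsupp.addHom_ext fun w c' => ?_
      refine (consAction_single v _ w c').trans
        (Eq.trans ?_ (congrArg (c • ·) (consAction_single v s w c')).symm)
      rw [← smul_comm c (op c') s, map_smul]
      exact Finsupp.mapDomain_smul _ _)
    (fun c s => by
      refine Finsupp.addHom_ext fun w c' => ?_
      refine (consAction_single v _ w c').trans (Eq.trans ?_ (congrArg (consAction v s)
        (Finsupp.smul_single c w c').symm))
      rw [consAction_single, smul_smul, smul_eq_mul, MulOpposite.op_mul])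
  replace hC : ∀ c x, h (i c) x = c • x := fun c x =>
    DFunLike.congr_fun (DFunLike.congr_fun hC c) x
  let φ := wordEval i (fun w : List I => (w.map fun x => j (v x)).prod)
  have hφ : ∀ w s, φ (Finsupp.mapDomain (· :: w) (v.repr s)) =
      j s * (w.map fun x => j (v x)).prod := by
    intro w s
    suffices φ.comp ((Finsupp.mapDomain.addMonoidHom (· :: w)).comp
        v.repr.toAddEquiv.toAddMonoidHom) = (AddMonoidHom.mulRight _).comp j from
      DFunLike.congr_fun this s
    refine Tens.addHom_ext_basis v fun c k => ?_
    change φ (Finsupp.mapDomain (· :: w) (v.repr (c • v k))) = j (c • v k) * _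
    rw [map_smul, v.repr_self, Finsupp.smul_single, Finsupp.mapDomain_single, wordEval_single,
      hR.map_left, smul_eq_mul, mul_one, List.map_cons, List.prod_cons, mul_assoc]
  refine exists_basis_of_action _ h hC ?_ [] rfl fun w => ?_
  · refine hR.subring_eq_top _ (fun c x => by rw [hC, wordEval_smul]) fun s x => ?_
    rw [hS]
    suffices φ.comp (consAction v s) = (AddMonoidHom.mulLeft (j s)).comp φ from
      DFunLike.congr_fun this x
    refine Finsupp.addHom_ext fun w c => ?_
    refine (congrArg φ (consAction_single v s w c)).trans ?_
    rw [hφ, hR.map_right, mul_assoc]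
    exact congrArg (j s * ·)
      (wordEval_single i (fun w : List I => (w.map fun x => j (v x)).prod) w c).symm
  · induction w with
    | nil => simp
    | cons x w ih =>
      rw [List.map_cons, List.prod_cons, map_mul, AddMonoid.End.coe_mul, Function.comp_apply, ih,
        hS, consAction_single, op_one, one_smul, v.repr_self, Finsupp.mapDomain_single]

/-- The standard resolution of length one over a tensor algebra. -/
theorem mem_of_tens_mem (hR : IsTensorAlgebra i j) (v : Module.Basis I C S)
    {P : ObjectProperty (RightMod R)} (hP : IsExactClass P) {M : Type u} [AddCommGroup M]
    [Module Rᵐᵒᵖ M] [Module Cᵐᵒᵖ M] (hM : ∀ (c : C) (m : M), op c • m = op (i c) • m)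
    (h₂ : ∀ b : Module.Basis (List I) C (Via i), P (ModuleCat.of Rᵐᵒᵖ (Tens b M)))
    (h₁ : ∀ b : Module.Basis (List I) C (Via i), P (ModuleCat.of Rᵐᵒᵖ (Tens b (Tens v M)))) :
    P (ModuleCat.of Rᵐᵒᵖ M) := by
  obtain ⟨b, hb⟩ := hR.exists_basis v
  let p : I → R := fun x => j (v x)
  replace hb : ∀ w, b w = Via.of i (w.map p).prod := hb
  let t : M →+ R →+ Tens b M :=
    (AddMonoidHom.compHom.flip (Via.of i).toAddMonoidHom).comp (Tens.tmul b)
  have ht : ∀ m r, t m r = Tens.tmul b m (Via.of i r) := fun _ _ => rfl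
  have t_mul : ∀ m c r, t m (i c * r) = t (op (i c) • m) r := fun m c r =>
    Tens.tmul_map_mul b hM m c r
  have smul_t : ∀ m r r', op r' • t m r = t m (r * r') := fun m r r' => by
    rw [ht, Tens.smul_tmul]
    rfl
  -- This is `(m, s) ↦ m ⊗ s - ms ⊗ 1`; the differential is its extension to an `R`-linear map.
  let G : M →+ S →+ Tens b M :=
    AddMonoidHom.mk' (fun m => AddMonoidHom.mk' (fun s => t m (j s) - t (op (j s) • m) 1)
      fun x y => by simp only [map_add, MulOpposite.op_add, add_smul, AddMonoidHom.add_apply]; abel)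
      fun x y => by
        ext s
        simp only [map_add, smul_add, AddMonoidHom.add_apply, AddMonoidHom.mk'_apply]
        abel
  have hG : ∀ m s, Tens.lift v G (Tens.tmul v m s) = t m (j s) - t (op (j s) • m) 1 := by
    refine Tens.lift_tmul v G fun m c s => ?_
    change t _ _ - t _ _ = t _ _ - t _ _
    rw [hR.map_left, t_mul, hM, MulOpposite.op_mul, mul_smul]
  let g : Tens v M →ₛₗ[RingHom.op i] Tens b M :=
    { toFun := Tens.lift v G
      map_add' := map_add _
      map_smul' := fun c x => by
        suffices (Tens.lift v G).comp (DistribSMul.toAddMonoidHom _ c) =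
            (DistribSMul.toAddMonoidHom (Tens b M) (op (i c.unop))).comp (Tens.lift v G) from
          DFunLike.congr_fun this x
        refine Tens.addHom_ext_tmul fun m k => ?_
        simp only [AddMonoidHom.comp_apply, DistribSMul.toAddMonoidHom_apply, Tens.smul_tmul, hG,
          smul_sub, smul_t]
        obtain ⟨c, rfl⟩ := op_surjective c
        rw [hR.map_right, unop_op, MulOpposite.op_mul, mul_smul, ← t_mul, mul_one, one_mul] }
  let t' : Tens v M →+ R →+ Tens b (Tens v M) :=
    (AddMonoidHom.compHom.flip (Via.of i).toAddMonoidHom).comp (Tens.tmul b)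
  let d : Tens b (Tens v M) →ₗ[Rᵐᵒᵖ] Tens b M := adjoint b g
  have hd : ∀ m s r, d (t' (Tens.tmul v m s) r) = t m (j s * r) - t (op (j s) • m) r := by
    intro m s r
    refine (adjoint_tmul b g _ _).trans ?_
    change op r • Tens.lift v G _ = _
    rw [hG, smul_sub, smul_t, smul_t, one_mul]
  let ε : Tens b M →ₗ[Rᵐᵒᵖ] M := adjoint b (semilinearId hM)
  have hε : ∀ m r, ε (t m r) = op r • m := fun m r => adjoint_tmul b _ _ _
  let k := listContraction (M := M) p fun x r => (t'.flip r).comp ((Tens.tmul v).flip (v x))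
  have hk : ∀ x w m, k (x :: w) m =
    t' (Tens.tmul v m (v x)) (w.map p).prod + k w (op (p x) • m) := fun _ _ _ => rfl
  let h : Tens b M →+ Tens b (Tens v M) := Tens.extend b k
  have hh : ∀ m w, h (t m (w.map p).prod) = k w m := fun m w => by
    rw [ht, ← hb, Tens.tmul_basis, Tens.extend_single]
  have hcons : ∀ x w, j (v x) * (List.map p w).prod = ((x :: w).map p).prod := fun x w =>
    List.prod_cons.symm
  refine hP.mem_of_contraction d ε h (t.flip 1) ?_ ?_ ?_ (h₁ b) (h₂ b)
  · intro y
    suffices h.comp d.toAddMonoidHom = AddMonoidHom.id _ from DFunLike.congr_fun this y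
    refine Tens.addHom_ext_tmul fun n w => ?_
    rw [hb]
    change h (d (t' n (w.map p).prod)) = t' n (w.map p).prod
    suffices h.comp (d.toAddMonoidHom.comp (t'.flip (w.map p).prod)) = t'.flip (w.map p).prod from
      DFunLike.congr_fun this n
    refine Tens.addHom_ext_tmul fun m x => ?_
    change h (d (t' (Tens.tmul v m (v x)) (w.map p).prod)) =
      t' (Tens.tmul v m (v x)) (w.map p).prod
    rw [hd, map_sub, hh]
    -- The contraction on `xw` is its new leading term plus the contraction on `w` at `mx`;
    -- subtracting the latter leaves the basis element started from.
    rw [hcons, hh, hk, add_sub_cancel_right]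
  · intro y
    suffices d.toAddMonoidHom.comp h + (t.flip 1).comp ε.toAddMonoidHom = AddMonoidHom.id _ from
      DFunLike.congr_fun this y
    refine Tens.addHom_ext_tmul fun m w => ?_
    rw [hb]
    change d (h (t m (w.map p).prod)) + t (ε (t m (w.map p).prod)) 1 = t m (w.map p).prod
    rw [hh, hε]
    induction w generalizing m with
    | nil =>
      change d 0 + t (op 1 • m) 1 = t m 1
      rw [map_zero, zero_add, op_one, one_smul]
    | cons x w ih =>
      rw [hk, map_add, hd, List.map_cons, List.prod_cons, MulOpposite.op_mul, mul_smul, add_assoc,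
        ih, sub_add_cancel]
  · intro m
    change ε (t m 1) = m
    rw [hε, op_one, one_smul]

/-- Both terms resolving `M` are extended from `C`, namely from `M` and from `M ⊗_C S`, so
regularity of `C` suffices. -/
theorem isRightRegular (hR : IsTensorAlgebra i j) [Module.Free C S] (hC : IsRightRegular C) :
    IsRightRegular R := by
  intro M P hP hPR
  let v := Module.Free.chooseBasis C S
  let _ : Module Cᵐᵒᵖ M := Module.compHom M (RingHom.op i)
  exact hR.mem_of_tens_mem v hP (fun _ _ => rfl)
    (fun b => hC.extension_mem b hP hPR (ModuleCat.of Cᵐᵒᵖ M))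
    fun b => hC.extension_mem b hP hPR (ModuleCat.of Cᵐᵒᵖ (Tens v M))

end IsTensorAlgebra

end TensorAlgebra

/-! ### Laurent extensions: reduced words and the Mayer-Vietoris sequence -/

section Laurent

/-- Whether a letter may precede a word: a letter `t` must not be followed directly by `t⁻¹`, nor
`t⁻¹` by `t`. -/
def Compatible {I J : Type*} : Option J ⊕ Option I → List (Option J ⊕ Option I) → Prop
  | Sum.inl none, Sum.inr _ :: _ => False
  | Sum.inr none, Sum.inl _ :: _ => False
  | _, _ => True

/-- Reduced words in letters `t y` and `t⁻¹ x`. -/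
def Reduced {I J : Type*} : List (Option J ⊕ Option I) → Prop
  | [] => True
  | l :: w => Compatible l w ∧ Reduced w

/-- The type of reduced words. -/
abbrev LaurentWord (I J : Type u) : Type u := {w : List (Option J ⊕ Option I) // Reduced w}

namespace LaurentWord

variable {I J : Type u}

/-- Multiplication by `t`. -/
def mulT : LaurentWord I J × Option J → LaurentWord I J × Option I
  | (⟨Sum.inr x :: w, h⟩, none) => (⟨w, h.2⟩, x)
  | (⟨[], _⟩, none) => (⟨[Sum.inl none], trivial, trivial⟩, none)
  | (⟨Sum.inl y :: w, h⟩, none) => (⟨Sum.inl none :: Sum.inl y :: w, trivial, h⟩, none)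
  | (⟨w, h⟩, some y) => (⟨Sum.inl (some y) :: w, trivial, h⟩, none)

/-- Multiplication by `t⁻¹`. -/
def mulTInv : LaurentWord I J × Option I → LaurentWord I J × Option J
  | (⟨Sum.inl y :: w, h⟩, none) => (⟨w, h.2⟩, y)
  | (⟨[], _⟩, none) => (⟨[Sum.inr none], trivial, trivial⟩, none)
  | (⟨Sum.inr x :: w, h⟩, none) => (⟨Sum.inr none :: Sum.inr x :: w, trivial, h⟩, none)
  | (⟨w, h⟩, some x) => (⟨Sum.inr (some x) :: w, trivial, h⟩, none)

/-- Multiplication by `t` is a bijection. -/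
def mulEquiv : LaurentWord I J × Option J ≃ LaurentWord I J × Option I where
  toFun := mulT
  invFun := mulTInv
  left_inv := by
    rintro ⟨⟨w, h⟩, _ | y⟩
    · rcases w with _ | ⟨y | x, w⟩
      · rfl
      · rfl
      · rcases x with _ | x
        · rcases w with _ | ⟨y' | x', w⟩
          · rfl
          · exact h.1.elim
          · rfl
        · rcases w with _ | ⟨_ | _, w⟩ <;> rfl
    · rcases w with _ | ⟨_ | _, w⟩ <;> rfl
  right_inv := by
    rintro ⟨⟨w, h⟩, _ | y⟩
    · rcases w with _ | ⟨y | x, w⟩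
      · rfl
      · rcases y with _ | y
        · rcases w with _ | ⟨y' | x', w⟩
          · rfl
          · rfl
          · exact h.1.elim
        · rcases w with _ | ⟨_ | _, w⟩ <;> rfl
      · rfl
    · rcases w with _ | ⟨_ | _, w⟩ <;> rfl

theorem mulT_of_compatible {w : List (Option J ⊕ Option I)} {y : Option J}
    (h : Reduced (Sum.inl y :: w)) : mulT (⟨w, h.2⟩, y) = (⟨Sum.inl y :: w, h⟩, none) := by
  rcases y with _ | y
  · rcases w with _ | ⟨y' | x', w⟩
    · rfl
    · rfl
    · exact h.1.elim
  · rcases w with _ | ⟨_ | _, w⟩ <;> rfl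

end LaurentWord

variable {I J : Type u} {R M T : Type*} [Ring R] [AddCommGroup M] [AddCommGroup T]
  [Module Rᵐᵒᵖ M]

/-- The value of a letter. -/
def letterVal (t : Rˣ) (p : Option I → R) (q : Option J → R) : Option J ⊕ Option I → R
  | Sum.inl y => t * q y
  | Sum.inr x => (t⁻¹ : Rˣ) * p x

/-- This ties the bijection on words to multiplication by `t` in `R`: either a letter is prepended,
or `t` cancels a leading `t⁻¹`. The normalizations at `none` say that an absent letter has value
`1`. -/
theorem mul_val_of_mulT (t : Rˣ) {p : Option I → R} {q : Option J → R} (hp : p none = 1)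
    (hq : q none = 1) {w w' : LaurentWord I J} {x : Option I} {y : Option J}
    (h : LaurentWord.mulT (w, y) = (w', x)) :
    p x * (w'.1.map (letterVal t p q)).prod = t * (q y * (w.1.map (letterVal t p q)).prod) := by
  obtain ⟨w, hw⟩ := w
  rcases y with _ | y
  · rcases w with _ | ⟨y | x, w⟩ <;> obtain ⟨rfl, rfl⟩ := Prod.mk.inj h <;>
      simp [letterVal, hp, hq, mul_assoc]
  · rw [LaurentWord.mulT_of_compatible (w := w) (y := some y) ⟨trivial, hw⟩] at h
    obtain ⟨rfl, rfl⟩ := Prod.mk.inj h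
    simp [letterVal, hp, mul_assoc]

/-- The values on words of the contraction of the Mayer-Vietoris sequence. -/
def laurentContraction (t : Rˣ) (p : Option I → R) (q : Option J → R) (τ : R → M →+ T) :
    List (Option J ⊕ Option I) → M →+ T
  | [] => 0
  | Sum.inl y :: w => τ (t * (q y * (w.map (letterVal t p q)).prod)) +
      (laurentContraction t p q τ w).comp (DistribSMul.toAddMonoidHom M (op (t * q y)))
  | Sum.inr x :: w => (laurentContraction t p q τ w).comp
        (DistribSMul.toAddMonoidHom M (op ((t⁻¹ : Rˣ) * p x))) -
      (τ (p x * (w.map (letterVal t p q)).prod)).comp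
        (DistribSMul.toAddMonoidHom M (op ((t⁻¹ : Rˣ) : R)))

namespace IsLaurentExtension

variable {C A R : Type u} [Ring C] [Ring A] [Ring R] {α β : C →+* A} {i : A →+* R} {t : Rˣ}

theorem subring_eq_top (hR : IsLaurentExtension α β i t) (U : Subring R) (hi : ∀ a, i a ∈ U)
    (ht : (t : R) ∈ U) (ht' : ((t⁻¹ : Rˣ) : R) ∈ U) : U = ⊤ := by
  obtain ⟨k, ⟨hk, hk'⟩, -⟩ := hR.existsUnique_lift U (i.codRestrict U hi)
    ⟨⟨t, ht⟩, ⟨_, ht'⟩, Subtype.ext t.mul_inv, Subtype.ext t.inv_mul⟩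
    fun c => Subtype.ext (hR.comm c)
  have : U.subtype.comp k = RingHom.id R :=
    (hR.existsUnique_lift R i t hR.comm).unique
      ⟨RingHom.ext fun c => congrArg Subtype.val (DFunLike.congr_fun hk c),
        congrArg Subtype.val hk'⟩ ⟨rfl, rfl⟩
  refine eq_top_iff.2 fun r _ => ?_
  have hr : (k r : R) = r := DFunLike.congr_fun this r
  exact hr ▸ (k r).2

/-- The normal form theorem for Laurent extensions. -/
theorem exists_basis (hR : IsLaurentExtension α β i t)
    (a : Module.Basis (Option I) C (Via α)) (ha : a none = Via.of α 1)
    (b : Module.Basis (Option J) C (Via β)) (hb : b none = Via.of β 1)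
    (p : Option I → R) (hp : ∀ x, p x = i ((Via.of α).symm (a x)))
    (q : Option J → R) (hq : ∀ y, q y = i ((Via.of β).symm (b y))) :
    ∃ v : Module.Basis (LaurentWord I J) A (Via i),
      ∀ w, v w = Via.of i (w.1.map (letterVal t p q)).prod := by
  -- The action of `t`: coefficients are expanded over `C` through `β` at the source and through `α`
  -- at the target, as dictated by `t β(c) = α(c) t`.
  let θ : (LaurentWord I J →₀ A) ≃+ (LaurentWord I J →₀ A) :=
    transfer b a LaurentWord.mulEquiv
  have hθ : ∀ {w x w' y}, LaurentWord.mulT (w, y) = (w', x) → ∀ c,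
      θ (Finsupp.single w (β c * (Via.of β).symm (b y))) =
        Finsupp.single w' (α c * (Via.of α).symm (a x)) :=
    fun h c => transfer_single b a LaurentWord.mulEquiv h c
  have ha' : (Via.of α).symm (a none) = 1 := by rw [ha, AddEquiv.symm_apply_apply]
  have hb' : (Via.of β).symm (b none) = 1 := by rw [hb, AddEquiv.symm_apply_apply]
  have hp₁ : p none = 1 := by rw [hp, ha', map_one]
  have hq₁ : q none = 1 := by rw [hq, hb', map_one]
  let s : (AddMonoid.End (LaurentWord I J →₀ A))ˣ :=
    ⟨θ.toAddMonoidHom, θ.symm.toAddMonoidHom, AddMonoidHom.ext θ.apply_symm_apply,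
      AddMonoidHom.ext θ.symm_apply_apply⟩
  obtain ⟨h, ⟨hA, hT⟩, -⟩ := hR.existsUnique_lift (AddMonoid.End (LaurentWord I J →₀ A))
    (Module.toAddMonoidEnd A (LaurentWord I J →₀ A)) s fun c => by
      ext1 x
      exact (transfer_smul b a LaurentWord.mulEquiv c x).symm
  replace hA : ∀ a x, h (i a) x = a • x := fun a x =>
    DFunLike.congr_fun (DFunLike.congr_fun hA a) x
  have hT' : h ((t⁻¹ : Rˣ) : R) = ((s⁻¹ : (AddMonoid.End (LaurentWord I J →₀ A))ˣ) :
      AddMonoid.End (LaurentWord I J →₀ A)) := by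
    have : Units.map (h : R →* AddMonoid.End (LaurentWord I J →₀ A)) t = s := Units.ext hT
    rw [← this, ← map_inv]
    rfl
  replace hT : ∀ x, h (t : R) x = θ x := fun x => DFunLike.congr_fun hT x
  replace hT' : ∀ x, h ((t⁻¹ : Rˣ) : R) x = θ.symm x := fun x => DFunLike.congr_fun hT' x
  let φ := wordEval i fun w : LaurentWord I J => (w.1.map (letterVal t p q)).prod
  have hφs : ∀ w a, φ (Finsupp.single w a) = i a * (w.1.map (letterVal t p q)).prod :=
    wordEval_single _ _
  have hφθ : ∀ x, φ (θ x) = t * φ x := by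
    intro x
    suffices φ.comp θ.toAddMonoidHom = (AddMonoidHom.mulLeft (t : R)).comp φ from
      DFunLike.congr_fun this x
    refine finsupp_addHom_ext_basis b fun w y c => ?_
    change φ (θ _) = t * φ _
    have hw := (Prod.mk.eta (p := LaurentWord.mulT (w, y))).symm
    rw [hθ hw, hφs, hφs, map_mul, map_mul, ← hp, ← hq, mul_assoc, mul_val_of_mulT t hp₁ hq₁ hw,
      ← mul_assoc, hR.comm, mul_assoc, mul_assoc]
  refine exists_basis_of_action _ h hA ?_ ⟨[], trivial⟩ rfl ?_
  · refine hR.subring_eq_top _ (fun a x => ?_) (fun x => ?_) fun x => ?_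
    · rw [hA, wordEval_smul]
    · rw [hT]
      exact hφθ x
    · rw [hT']
      refine (t.inv_mul_eq_iff_eq_mul.2 ?_).symm
      exact (congrArg φ (θ.apply_symm_apply x)).symm.trans (hφθ _)
  · rintro ⟨w, hw⟩
    induction w with
    | nil => exact DFunLike.congr_fun (map_one h) _
    | cons l w ih =>
      rcases l with y | x
      · rw [List.map_cons, List.prod_cons, letterVal, mul_assoc, map_mul, map_mul]
        change h t (h (q y) (h _ _)) = _
        rw [ih hw.2, hq, hA, hT, Finsupp.smul_single, smul_eq_mul, mul_one]
        simpa [ha'] using hθ (LaurentWord.mulT_of_compatible hw) 1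
      · rw [List.map_cons, List.prod_cons, letterVal, mul_assoc, map_mul, map_mul]
        change h (t⁻¹ : Rˣ) (h (p x) (h _ _)) = _
        rw [ih hw.2, hp, hA, hT', Finsupp.smul_single, smul_eq_mul, mul_one,
          AddEquiv.symm_apply_eq]
        have := hθ (w := ⟨Sum.inr x :: w, hw⟩) (y := none) (w' := ⟨w, hw.2⟩) (x := x) rfl 1
        simpa [hb'] using this.symm

/-- The Mayer-Vietoris sequence of a Laurent extension. -/
theorem mem_of_tens_mem (hR : IsLaurentExtension α β i t)
    (a : Module.Basis (Option I) C (Via α)) (ha : a none = Via.of α 1)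
    (b : Module.Basis (Option J) C (Via β)) (hb : b none = Via.of β 1)
    {P : ObjectProperty (RightMod R)} (hP : IsExactClass P) {M : Type u} [AddCommGroup M]
    [Module Rᵐᵒᵖ M] [Module Aᵐᵒᵖ M] [Module Cᵐᵒᵖ M]
    (hMA : ∀ (a : A) (m : M), op a • m = op (i a) • m)
    (hMC : ∀ (c : C) (m : M), op c • m = op (i (α c)) • m)
    (hA : ∀ v : Module.Basis (LaurentWord I J) A (Via i), P (ModuleCat.of Rᵐᵒᵖ (Tens v M)))
    (hC : ∀ v : Module.Basis (Option I × LaurentWord I J) C (Via (i.comp α)),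
      P (ModuleCat.of Rᵐᵒᵖ (Tens v M))) :
    P (ModuleCat.of Rᵐᵒᵖ M) := by
  let p : Option I → R := fun x => i ((Via.of α).symm (a x))
  let q : Option J → R := fun y => i ((Via.of β).symm (b y))
  have hp₁ : p none = 1 := by
    change i ((Via.of α).symm (a none)) = 1
    rw [ha, AddEquiv.symm_apply_apply, map_one]
  obtain ⟨vA, hvA⟩ := hR.exists_basis a ha b hb p (fun _ => rfl) q fun _ => rfl
  let val : List (Option J ⊕ Option I) → R := fun w => (w.map (letterVal t p q)).prod
  have val_inl : ∀ y w, val (Sum.inl y :: w) = t * (q y * val w) := fun y w => by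
    simp only [val, List.map_cons, List.prod_cons, letterVal, mul_assoc]
  have val_inr : ∀ x w, val (Sum.inr x :: w) = (t⁻¹ : Rˣ) * (p x * val w) := fun x w => by
    simp only [val, List.map_cons, List.prod_cons, letterVal, mul_assoc]
  let vC := compBasis a vA
  have hvC : ∀ x w, vC (x, w) = Via.of _ (p x * val w.1) := fun x w => by
    rw [compBasis_apply, hvA, AddEquiv.symm_apply_apply]
  let tA : M →+ R →+ Tens vA M :=
    (AddMonoidHom.compHom.flip (Via.of i).toAddMonoidHom).comp (Tens.tmul vA)
  have htA : ∀ m r, tA m r = Tens.tmul vA m (Via.of i r) := fun _ _ => rfl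
  let tC : M →+ R →+ Tens vC M :=
    (AddMonoidHom.compHom.flip (Via.of (i.comp α)).toAddMonoidHom).comp (Tens.tmul vC)
  have tA_mul : ∀ m a r, tA m (i a * r) = tA (op (i a) • m) r := fun m a r =>
    Tens.tmul_map_mul vA hMA m a r
  have smul_tA : ∀ m r r', op r' • tA m r = tA m (r * r') := fun m r r' => by
    rw [htA, Tens.smul_tmul]
    rfl
  -- The second term is linear over `C` since `m α(c) t ⊗ t⁻¹ = m t β(c) ⊗ t⁻¹ = m t ⊗ t⁻¹ α(c)`.
  let g : M →ₛₗ[RingHom.op (i.comp α)] Tens vA M :=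
    { toFun := fun m => tA m 1 - tA (op (t : R) • m) (t⁻¹ : Rˣ)
      map_add' := fun x y => by
        simp only [smul_add, map_add, AddMonoidHom.add_apply]
        abel
      map_smul' := fun c m => by
        obtain ⟨c, rfl⟩ := op_surjective c
        change _ = op (i (α c)) • _
        rw [hMC, smul_sub, smul_tA, smul_tA, one_mul, ← mul_smul, ← MulOpposite.op_mul, hR.comm,
          MulOpposite.op_mul, mul_smul, ← tA_mul, ← tA_mul, mul_one]
        congr 2
        rw [Units.eq_inv_mul_iff_mul_eq, ← mul_assoc, ← hR.comm, mul_assoc, t.mul_inv, mul_one] }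
  let d : Tens vC M →ₗ[Rᵐᵒᵖ] Tens vA M := adjoint vC g
  have hd : ∀ m r, d (tC m r) = tA m r - tA (op (t : R) • m) ((t⁻¹ : Rˣ) * r) := fun m r => by
    refine (adjoint_tmul vC g m r).trans ?_
    change op r • (tA m 1 - tA (op (t : R) • m) (t⁻¹ : Rˣ)) = _
    rw [smul_sub, smul_tA, smul_tA, one_mul]
  let ε : Tens vA M →ₗ[Rᵐᵒᵖ] M := adjoint vA (semilinearId hMA)
  have hε : ∀ m r, ε (tA m r) = op r • m := fun m r => adjoint_tmul vA _ _ _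
  let k := laurentContraction (M := M) t p q fun r => tC.flip r
  have k_inl : ∀ y w m, k (Sum.inl y :: w) m =
      tC m (t * (q y * val w)) + k w (op (t * q y) • m) := fun _ _ _ => rfl
  have k_inr : ∀ x w m, k (Sum.inr x :: w) m = k w (op ((t⁻¹ : Rˣ) * p x) • m) -
      tC (op ((t⁻¹ : Rˣ) : R) • m) (p x * val w) := fun _ _ _ => rfl
  let h : Tens vA M →+ Tens vC M := Tens.extend vA fun w => k w.1
  have hh : ∀ m w, Reduced w → h (tA m (val w)) = k w m := fun m w hw => by
    rw [htA, ← hvA ⟨w, hw⟩, Tens.tmul_basis, Tens.extend_single]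
  refine hP.mem_of_contraction d ε h (tA.flip 1) ?_ ?_ ?_ (hC vC) (hA vA)
  · intro y
    suffices h.comp d.toAddMonoidHom = AddMonoidHom.id _ from DFunLike.congr_fun this y
    refine Tens.addHom_ext_tmul fun m ⟨x, w, hw⟩ => ?_
    rw [hvC]
    change h (d (tC m (p x * val w))) = tC m (p x * val w)
    rw [hd, map_sub]
    -- If `t⁻¹x` may precede `w`, the second term of the boundary sits on the longer reduced word.
    -- Otherwise `x` is trivial and `w` starts with `t`, so `t⁻¹` cancels and that term sits on the
    -- tail of `w`, once the next letter has slid across.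
    by_cases hxw : Compatible (Sum.inr x) w
    · rw [tA_mul, hh _ _ hw, ← val_inr, hh _ (Sum.inr x :: w) ⟨hxw, hw⟩, k_inr,
        ← mul_smul, ← mul_smul,
        ← MulOpposite.op_mul, ← MulOpposite.op_mul, t.mul_inv_cancel_left, t.mul_inv, op_one,
        one_smul, sub_sub_cancel]
    · rcases x with _ | x
      · rcases w with _ | ⟨y | x, w⟩
        · exact (hxw trivial).elim
        · rw [hp₁, one_mul, hh _ _ hw, val_inl, t.inv_mul_cancel_left, tA_mul, hh _ _ hw.2, k_inl,
            MulOpposite.op_mul, mul_smul, add_sub_cancel_right]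
        · exact (hxw trivial).elim
      · exact (hxw trivial).elim
  · intro y
    suffices d.toAddMonoidHom.comp h + (tA.flip 1).comp ε.toAddMonoidHom = AddMonoidHom.id _ from
      DFunLike.congr_fun this y
    refine Tens.addHom_ext_tmul fun m ⟨w, hw⟩ => ?_
    rw [hvA]
    change d (h (tA m (val w))) + tA (ε (tA m (val w))) 1 = tA m (val w)
    rw [hh _ _ hw, hε]
    -- Reducedness served only to evaluate `h`; the remaining identity telescopes for every list of
    -- letters.
    clear hw
    induction w generalizing m with
    | nil =>
      change d 0 + tA (op 1 • m) 1 = tA m 1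
      rw [map_zero, zero_add, op_one, one_smul]
    | cons l w ih =>
      rcases l with y | x
      · have := ih (op (t * q y) • m)
        rw [k_inl, map_add, hd, val_inl, ← mul_assoc, MulOpposite.op_mul _ (val w), mul_smul,
          add_assoc, this, mul_assoc, t.inv_mul_cancel_left, tA_mul, ← mul_smul,
          ← MulOpposite.op_mul, sub_add_cancel]
      · have := ih (op ((t⁻¹ : Rˣ) * p x) • m)
        rw [k_inr, map_sub, hd, val_inr, ← mul_assoc _ (p x), MulOpposite.op_mul _ (val w),
          mul_smul, sub_add_eq_add_sub, this, tA_mul, ← mul_smul, ← MulOpposite.op_mul,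
          ← mul_smul, ← MulOpposite.op_mul, t.inv_mul, op_one, one_smul, mul_assoc, sub_sub_cancel]
  · intro m
    change ε (tA m 1) = m
    rw [hε, op_one, one_smul]

theorem isRightRegular (hR : IsLaurentExtension α β i t) (hα : IsPureEmbeddingLeftFree α)
    (hβ : IsPureEmbeddingLeftFree β) (hC : IsRightRegular C) (hA : IsRightRegular A) :
    IsRightRegular R := by
  intro M P hP hPR
  obtain ⟨I, a, ha⟩ := hα.exists_basis
  obtain ⟨J, b, hb⟩ := hβ.exists_basis
  let _ : Module Aᵐᵒᵖ M := Module.compHom M (RingHom.op i)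
  let _ : Module Cᵐᵒᵖ M := Module.compHom M (RingHom.op (i.comp α))
  exact hR.mem_of_tens_mem a ha b hb hP (fun _ _ => rfl) (fun _ _ => rfl)
    (fun v => hA.extension_mem v hP hPR (ModuleCat.of Aᵐᵒᵖ M))
    fun v => hC.extension_mem v hP hPR (ModuleCat.of Cᵐᵒᵖ M)

end IsLaurentExtension

end Laurent

end VogelRegular

theorem proposition5 :
    (∀ (C A B R : Type u) [Ring C] [Ring A] [Ring B] [Ring R]
      (α : C →+* A) (β : C →+* B) (i : A →+* R) (j : B →+* R),
      VogelRegular.IsPureEmbeddingLeftFree α → VogelRegular.IsPureEmbeddingLeftFree β →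
      VogelRegular.IsFreeProduct α β i j →
      VogelRegular.IsRightRegular C → VogelRegular.IsRightRegular A →
      VogelRegular.IsRightRegular B → VogelRegular.IsRightRegular R) ∧
    (∀ (C A R : Type u) [Ring C] [Ring A] [Ring R]
      (α β : C →+* A) (i : A →+* R) (t : Rˣ),
      VogelRegular.IsPureEmbeddingLeftFree α → VogelRegular.IsPureEmbeddingLeftFree β →
      VogelRegular.IsLaurentExtension α β i t →
      VogelRegular.IsRightRegular C → VogelRegular.IsRightRegular A →
      VogelRegular.IsRightRegular R) ∧
    (∀ (C S R : Type u) [Ring C] [AddCommGroup S] [Module C S] [Module Cᵐᵒᵖ S]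
      [SMulCommClass C Cᵐᵒᵖ S] [Ring R] (i : C →+* R) (j : S →+ R),
      Module.Free C S →
      VogelRegular.IsTensorAlgebra i j →
      VogelRegular.IsRightRegular C → VogelRegular.IsRightRegular R) :=
  ⟨fun _ _ _ _ _ _ _ _ _ _ _ _ hα hβ hR hC hA hB => hR.isRightRegular hα hβ hC hA hB,
    fun _ _ _ _ _ _ _ _ _ _ hα hβ hR hC hA => hR.isRightRegular hα hβ hC hA,
    fun _ _ _ _ _ _ _ _ _ _ _ _ hR hC => hR.isRightRegular hC⟩
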